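/- Let $\mathbb K\in\{\mathbb R,\mathbb C\}$, let $(X,\|\cdot\|)$ be a Banach space over $\mathbb K$ and $\tau$ a Hausdorff locally convex topology on $X$ that is coarser than the norm topology $\tau_{\|\cdot\|}$. *Definitions.* For a Hausdorff locally convex topology $\upsilon$ on $X$, a directed system of continuous seminorms $\Gamma_\upsilon$ generating $\upsilon$ is called *norming* if $\|x\|=\sup_{p\in\Gamma_\upsilon}p(x)$ for all $x\in X$. The triple $(X,\|\cdot\|,\tau)$ is a *Saks space* if there is a norming directed system of continuous seminorms generating $\tau$. The *mixed topology* $\gamma=\gamma(\|\cdot\|,\tau)$ is the finest linear topology on $X$ that coincides with $\tau$ on $\|\cdot\|$-bounded sets and satisfies $\tau\subseteq\gamma\subseteq\tau_{\|\cdot\|}$; the Saks space is *sequentially complete* if $(X,\gamma)$ is sequentially complete. A *$\tau$-bi-continuous semigroup* is a family $(T(t))_{t\ge0}$ of bounded linear operators on $(X,\|\cdot\|)$ such that (i) $T(0)=\mathrm{id}$ and $T(t+s)=T(t)T(s)$ for all $t,s\ge 0$; (ii) $t\mapsto T(t)x$ is $\tau$-continuous on $[0,\infty)$ for every $x\in X$;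 (iii) there are $M\ge1$ and $\omega\in\mathbb R$ with $\|T(t)\|\le Me^{\omega t}$ for all $t\ge0$; (iv) for every $\|\cdot\|$-bounded sequence $(x_n)$ in $X$ with $\tau\text{-}\lim_n x_n=x\in X$ one has $\tau\text{-}\lim_n T(t)(x_n-x)=0$ locally uniformly in $t\in[0,\infty)$. It is a *contraction* semigroup if $\|T(t)\|\le1$ for all $t\ge0$. Its *generator* $(A,D(A))$ is given by $$D(A)=\Bigl\{x\in X : \tau\text{-}\lim_{t\to0+}\tfrac{T(t)x-x}{t}\text{ exists in }X\text{ and }\sup_{t\in(0,1]}\tfrac{\|T(t)x-x\|}{t}<\infty\Bigr\},\qquad Ax=\tau\text{-}\lim_{t\to0+}\tfrac{T(t)x-x}{t}.$$ A linear operator $A\colon D(A)\subseteq X\to X$ is *bi-densely defined* if every $x\in X$ is the $\tau$-limit of a $\|\cdot\|$-bounded sequence in $D(A)$, and *$\Gamma_\upsilon$-dissipative* if $p((\lambda-A)x)\ge\lambda p(x)$ for all $\lambda>0$, $x\in D(A)$ and $p\in\Gamma_\upsilon$. **Proposition.** Let $(X,\|\cdot\|,\tau)$ be a sequentially complete Saks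 space, let $\upsilon$ be a Hausdorff locally convex topology on $X$ with $\tau\subseteq\upsilon\subseteq\tau_{\|\cdot\|}$ such that every $\gamma$-convergent sequence is $\upsilon$-convergent (to the same limit), and let $(A,D(A))$ be a bi-densely defined linear operator on $X$. Then the following assertions are equivalent: (a) $(A,D(A))$ generates a $\tau$-bi-continuous contraction semigroup $(T(t))_{t\ge0}$ on $X$, and there exists a norming directed system of continuous seminorms $\Gamma_\upsilon$ that generates $\upsilon$ such that $p(T(t)x)\le p(x)$ for all $t\ge0$, $p\in\Gamma_\upsilon$ and $x\in X$. (b) $\lambda-A\colon D(A)\to X$ is surjective for some $\lambda>0$, and $(A,D(A))$ is $\Gamma_\upsilon$-dissipative for some norming directed system of continuous seminorms $\Gamma_\upsilon$ that generates $\upsilon$. -/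

import Mathlib

open Filter Topology
open scoped NNReal

namespace BiCont

/-- `σ` is a linear (vector space) topology on `X`. -/
structure IsLinearTopology (𝕜 : Type*) {X : Type*} [RCLike 𝕜] [AddCommGroup X] [Module 𝕜 X]
    (σ : TopologicalSpace X) : Prop where
  isTopologicalAddGroup : @IsTopologicalAddGroup X σ _
  continuousSMul : @ContinuousSMul 𝕜 X _ _ σ

/-- `σ` is a Hausdorff locally convex topology on `X` (local convexity is expressed by
`PolynormableSpace`: the topology is induced by a family of seminorms). -/
structure IsHausdorffLocallyConvex (𝕜 : Type*) {X : Type*} [RCLike 𝕜] [AddCommGroup X]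
    [Module 𝕜 X] (σ : TopologicalSpace X) : Prop where
  polynormable : @PolynormableSpace 𝕜 X _ _ _ σ
  t2 : @T2Space X σ

/-- `Γ` is a directed system of (automatically `σ`-continuous) seminorms that generates `σ`. -/
structure IsGeneratingSystem {𝕜 X : Type*} [RCLike 𝕜] [AddCommGroup X] [Module 𝕜 X]
    (σ : TopologicalSpace X) (Γ : Set (Seminorm 𝕜 X)) : Prop where
  nonempty : Γ.Nonempty
  directed : DirectedOn (· ≤ ·) Γ
  generates : @WithSeminorms 𝕜 X Γ _ _ _ (fun p : Γ => (p : Seminorm 𝕜 X)) σ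

/-- A linear operator `(A, D(A))` on `X` is `Γ`-dissipative if `p ((λ - A) x) ≥ λ p(x)` for all
`λ > 0`, `x ∈ D(A)` and `p ∈ Γ`. -/
def IsDissipative {𝕜 X : Type*} [RCLike 𝕜] [AddCommGroup X] [Module 𝕜 X]
    (Γ : Set (Seminorm 𝕜 X)) (A : X →ₗ.[𝕜] X) : Prop :=
  ∀ l : ℝ, 0 < l → ∀ x : A.domain, ∀ p ∈ Γ, l * p (x : X) ≤ p ((l : 𝕜) • (x : X) - A x)

/-- Every `σ`-Cauchy sequence is `σ`-convergent (for a linear topology `σ`). -/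
def IsSeqComplete {X : Type*} [AddCommGroup X] (σ : TopologicalSpace X) : Prop :=
  ∀ u : ℕ → X,
    Tendsto (fun m : ℕ × ℕ => u m.1 - u m.2) (atTop ×ˢ atTop) (@nhds X σ 0) →
    ∃ x : X, Tendsto u atTop (@nhds X σ x)

variable {𝕜 X : Type*} [RCLike 𝕜] [NormedAddCommGroup X] [NormedSpace 𝕜 X]

/-- The topology of the norm. -/
abbrev normTopology (X : Type*) [NormedAddCommGroup X] : TopologicalSpace X := inferInstance

/-- The space `𝓛(X)` of norm-continuous linear operators, with the operator norm. It is named so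
that topologies `τ`, `υ` in the context cannot be taken for the topology of `X`. -/
abbrev BoundedOperator (𝕜 X : Type*) [RCLike 𝕜] [NormedAddCommGroup X] [NormedSpace 𝕜 X] :
    Type _ :=
  X →L[𝕜] X

/-- `Γ` is norming: `‖x‖ = sup_{p ∈ Γ} p(x)` for all `x`. -/
def IsNorming (Γ : Set (Seminorm 𝕜 X)) : Prop :=
  ∀ x : X, IsLUB ((fun p : Seminorm 𝕜 X => p x) '' Γ) ‖x‖

/-- The linear topologies `σ` with `τ ⊆ σ ⊆ τ_‖·‖` that coincide with `τ` on norm-bounded sets.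
(In Mathlib's order on topologies, `σ ≤ τ` means that `σ` is finer than `τ`.) -/
def mixedCandidates (𝕜 : Type*) {X : Type*} [RCLike 𝕜] [NormedAddCommGroup X] [NormedSpace 𝕜 X]
    (τ : TopologicalSpace X) : Set (TopologicalSpace X) :=
  {σ | IsLinearTopology 𝕜 σ ∧ σ ≤ τ ∧ normTopology X ≤ σ ∧
    ∀ B : Set X, Bornology.IsBounded B →
      TopologicalSpace.induced ((↑) : B → X) σ = TopologicalSpace.induced ((↑) : B → X) τ}

/-- The mixed topology `γ(‖·‖, τ)`: the finest member of `mixedCandidates`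
(see `isLeast_mixedTopology`). -/
@[reducible] def mixedTopology (𝕜 : Type*) {X : Type*} [RCLike 𝕜] [NormedAddCommGroup X] [NormedSpace 𝕜 X]
    (τ : TopologicalSpace X) : TopologicalSpace X :=
  sInf (mixedCandidates 𝕜 τ)

theorem isLeast_mixedTopology {τ : TopologicalSpace X} (hτ : IsLinearTopology 𝕜 τ)
    (hn : normTopology X ≤ τ) :
    IsLeast (mixedCandidates 𝕜 τ) (mixedTopology 𝕜 τ) := by
  have hmem : τ ∈ mixedCandidates 𝕜 τ := ⟨hτ, le_rfl, hn, fun _ _ => rfl⟩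
  refine ⟨⟨⟨topologicalAddGroup_sInf fun σ hσ => hσ.1.1, continuousSMul_sInf fun σ hσ => hσ.1.2⟩,
    sInf_le hmem, le_sInf fun σ hσ => hσ.2.2.1, fun B hB => ?_⟩, fun σ hσ => sInf_le hσ⟩
  apply le_antisymm
  · exact induced_mono (sInf_le hmem)
  · rw [mixedTopology, induced_sInf]
    refine le_sInf ?_
    rintro _ ⟨σ, hσ, rfl⟩
    exact (hσ.2.2.2 B hB).ge

/-- `(X, ‖·‖, τ)` is a Saks space (completeness of the norm is a separate assumption). -/
structure IsSaksSpace (𝕜 : Type*) {X : Type*} [RCLike 𝕜] [NormedAddCommGroup X] [NormedSpace 𝕜 X]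
    (τ : TopologicalSpace X) : Prop where
  hausdorff_lc : IsHausdorffLocallyConvex 𝕜 τ
  coarser : normTopology X ≤ τ
  norming : ∃ Γ : Set (Seminorm 𝕜 X), IsGeneratingSystem τ Γ ∧ IsNorming Γ

/-- `(X, ‖·‖, τ)` is a sequentially complete Saks space: `(X, γ)` is sequentially complete. -/
structure IsSeqCompleteSaksSpace (𝕜 : Type*) {X : Type*} [RCLike 𝕜] [NormedAddCommGroup X]
    [NormedSpace 𝕜 X] (τ : TopologicalSpace X) : Prop where
  saks : IsSaksSpace 𝕜 τ
  seqComplete : IsSeqComplete (mixedTopology 𝕜 τ)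

/-- `(T(t))_{t ≥ 0}` is a `τ`-bi-continuous semigroup in `𝓛(X)`. -/
structure IsBiContinuousSemigroup (T : ℝ≥0 → BoundedOperator 𝕜 X) (τ : TopologicalSpace X) : Prop where
  map_zero : ∀ x : X, T 0 x = x
  map_add : ∀ (t s : ℝ≥0) (x : X), T (t + s) x = T t (T s x)
  /-- `τ`-strong continuity -/
  strongly_continuous : ∀ x : X, @Continuous ℝ≥0 X _ τ (fun t => T t x)
  /-- exponential boundedness -/
  exp_bounded : ∃ M ω : ℝ, 1 ≤ M ∧ ∀ t : ℝ≥0, ‖T t‖ ≤ M * Real.exp (ω * t)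
  /-- local bi-equicontinuity -/
  locally_bi_equicontinuous : ∀ (u : ℕ → X) (x : X), (∃ C : ℝ, ∀ n, ‖u n‖ ≤ C) →
    Tendsto u atTop (@nhds X τ x) →
    ∀ t₀ : ℝ≥0, ∀ U ∈ @nhds X τ 0, ∀ᶠ n in atTop, ∀ t ≤ t₀, T t (u n - x) ∈ U

/-- `(A, D(A))` is the generator of `(T(t))_{t ≥ 0}`: one has `x ∈ D(A)` and `A x = y` iff
`(T(t) x - x) / t` tends to `y` with respect to `τ` as `t → 0+` and
`sup_{t ∈ (0,1]} ‖T(t) x - x‖ / t < ∞`. -/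
def IsGenerator (T : ℝ≥0 → BoundedOperator 𝕜 X) (τ : TopologicalSpace X) (A : X →ₗ.[𝕜] X) : Prop :=
  ∀ x y : X, (∃ hx : x ∈ A.domain, A ⟨x, hx⟩ = y) ↔
    Tendsto (fun t : ℝ≥0 => (((t : ℝ) : 𝕜)⁻¹) • (T t x - x)) (𝓝[>] 0) (@nhds X τ y) ∧
    ∃ C : ℝ, ∀ t : ℝ≥0, 0 < t → t ≤ 1 → ‖T t x - x‖ / t ≤ C

/-- `‖T(t)‖ ≤ 1` for all `t ≥ 0`. -/
def IsContraction (T : ℝ≥0 → BoundedOperator 𝕜 X) : Prop :=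
  ∀ t : ℝ≥0, ‖T t‖ ≤ 1

/-- Each `x` is the `τ`-limit of a norm-bounded sequence in `D(A)`. -/
def IsBiDenselyDefined (τ : TopologicalSpace X) (A : X →ₗ.[𝕜] X) : Prop :=
  ∀ x : X, ∃ u : ℕ → X, (∀ n, u n ∈ A.domain) ∧ (∃ C : ℝ, ∀ n, ‖u n‖ ≤ C) ∧
    Tendsto u atTop (@nhds X τ x)

end BiCont

/-! The theorem is Lumer–Phillips carried out one seminorm at a time. The mixed topology enters only
through two facts about a system `Γ` generating `υ`: norm-bounded `τ`-convergent sequences converge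
for every `p ∈ Γ` (`seminormTendsto_of_bounded`), and norm-bounded `Γ`-Cauchy sequences have limits
(`boundedSeqComplete`). The norming property turns estimates valid for all `p ∈ Γ` into norm
estimates, so resolvents and semigroup operators are bounded and Neumann series are available.

From (b) to (a): surjectivity of one `l - A` spreads to all positive parameters. The Yosida
approximations `B n` are commuting bounded operators whose exponentials contract every `p ∈ Γ`. The
bound `p (exp (tB) x - exp (tB') x) ≤ t * p (B x - B' x)` makes these exponentials Cauchy on `D(A)`,
hence pointwise convergent by bi-density. The limit semigroup has a generator extending `A`; that
generator is dissipative and `l - A` is already onto, so the two coincide.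

From (a) to (b): dissipativity comes from difference quotients of a `p`-contraction. For
surjectivity of `1 - A`, the candidate for the resolvent at `x` is `y = ∫ exp (-t) T(t) x dt`. No
vector integral is formed: with `S t = exp (-t) T(t)`, the operators `h (1 - S h)⁻¹ = h ∑ S (k h)`
are its Riemann sums, and they are `Γ`-Cauchy along dyadic steps
(`IsDecayingSemigroup.exists_orbit_integral`). Likewise, telescoping sums over small time steps
replace integration of derivatives of exponentials. -/

namespace BiCont

/-! ### Telescoping estimates for powers of operators -/

section Telescoping

variable {𝕜 X : Type*} [RCLike 𝕜] [NormedAddCommGroup X] [NormedSpace 𝕜 X] {p : Seminorm 𝕜 X}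

theorem seminorm_ofReal_smul (p : Seminorm 𝕜 X) {r : ℝ} (hr : 0 ≤ r) (x : X) :
    p ((r : 𝕜) • x) = r * p x := by
  rw [map_smul_eq_mul, RCLike.norm_ofReal, abs_of_nonneg hr]

theorem seminorm_pow_le {U : X →L[𝕜] X} (hU : ∀ x, p (U x) ≤ p x) (n : ℕ) (x : X) :
    p ((U ^ n) x) ≤ p x := by
  induction n with
  | zero => simp
  | succ n ih =>
    rw [pow_succ']
    exact (hU _).trans ih

/-- Commutation lets each of the `n` differences `U - V` act first on `x`, before the contractions.
-/
theorem seminorm_pow_sub_pow_le {U V : X →L[𝕜] X} (hUV : Commute U V)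
    (hU : ∀ x, p (U x) ≤ p x) (hV : ∀ x, p (V x) ≤ p x) (n : ℕ) (x : X) :
    p ((U ^ n) x - (V ^ n) x) ≤ n * p (U x - V x) := by
  induction n with
  | zero => simp
  | succ n ih =>
    have hc : (U ^ n) (V x) = V ((U ^ n) x) :=
      congrArg (fun W : X →L[𝕜] X => W x) (hUV.pow_left n).eq
    have e : (U ^ (n + 1)) x - (V ^ (n + 1)) x
        = (U ^ n) (U x - V x) + V ((U ^ n) x - (V ^ n) x) := by
      rw [pow_succ, pow_succ', map_sub, map_sub, hc]
      simp
    rw [e]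
    have h1 := map_add_le_add p ((U ^ n) (U x - V x)) (V ((U ^ n) x - (V ^ n) x))
    have h2 := seminorm_pow_le hU n (U x - V x)
    have h3 := hV ((U ^ n) x - (V ^ n) x)
    rw [Nat.cast_succ]
    linarith

/-- Discrete form of `S t x - x - t z = ∫ (S s A x - z) ds`. It serves both the exponentials and the
Riemann sums of the resolvent. -/
theorem seminorm_pow_sub_nsmul_le (U : X →L[𝕜] X) (w : X) (n : ℕ) (x : X) :
    p ((U ^ n) x - x - n • w) ≤ ∑ k ∈ Finset.range n, p ((U ^ k) (U x - x) - w) := by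
  induction n with
  | zero => simp
  | succ n ih =>
    have e : (U ^ (n + 1)) x - x - (n + 1) • w
        = ((U ^ n) x - x - n • w) + ((U ^ n) (U x - x) - w) := by
      rw [pow_succ, map_sub, succ_nsmul, mul_apply_eq_comp]
      abel
    rw [e, Finset.sum_range_succ]
    exact (map_add_le_add p _ _).trans (by gcongr)

end Telescoping

/-! ### Exponentials of bounded operators, measured by one seminorm -/

section ExpSemigroup

variable {𝕜 X : Type*} [RCLike 𝕜] [NormedAddCommGroup X] [NormedSpace 𝕜 X]

/-- The norm-continuous (semi)group `exp (t B)` of a bounded operator `B`. -/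
noncomputable def expSemigroup (B : X →L[𝕜] X) (t : ℝ) : X →L[𝕜] X :=
  NormedSpace.exp ((t : 𝕜) • B)

@[simp] theorem expSemigroup_zero (B : X →L[𝕜] X) : expSemigroup B 0 = 1 := by
  simp [expSemigroup]

@[simp] theorem expSemigroup_zero_left (t : ℝ) : expSemigroup (0 : X →L[𝕜] X) t = 1 := by
  simp [expSemigroup]

theorem expSemigroup_commute {B B' : X →L[𝕜] X} (h : Commute B B') (s t : ℝ) :
    Commute (expSemigroup B s) (expSemigroup B' t) :=
  ((h.smul_left _).smul_right _).exp

variable [CompleteSpace X]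

theorem expSemigroup_add (B : X →L[𝕜] X) (s t : ℝ) :
    expSemigroup B (s + t) = expSemigroup B s * expSemigroup B t := by
  let : NormedAlgebra ℚ (X →L[𝕜] X) := NormedAlgebra.restrictScalars ℚ 𝕜 _
  rw [expSemigroup, RCLike.ofReal_add, add_smul, NormedSpace.exp_add_of_commute]
  · rfl
  · exact ((Commute.refl B).smul_left _).smul_right _

theorem expSemigroup_pow (B : X →L[𝕜] X) (t : ℝ) (n : ℕ) :
    expSemigroup B t ^ n = expSemigroup B (n * t) := by
  induction n with
  | zero => simp
  | succ n ih => rw [pow_succ, ih, ← expSemigroup_add]; congr 1; push_cast; ring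

theorem tendsto_expSemigroup_slope (B : X →L[𝕜] X) (x : X) :
    Tendsto (fun h : ℝ => ((h : 𝕜)⁻¹) • (expSemigroup B h x - x)) (𝓝[≠] 0) (𝓝 (B x)) := by
  have h1 := hasDerivAt_exp_smul_const (𝕂 := 𝕜) B (0 : 𝕜)
  rw [hasDerivAt_iff_tendsto_slope_zero] at h1
  have h2 : Tendsto (fun h : ℝ => (h : 𝕜)) (𝓝[≠] 0) (𝓝[≠] 0) := by
    refine tendsto_nhdsWithin_iff.2 ⟨?_, ?_⟩
    · have : Tendsto (fun h : ℝ => (h : 𝕜)) (𝓝 0) (𝓝 ((0 : ℝ) : 𝕜)) :=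
        RCLike.continuous_ofReal.tendsto 0
      simpa using this.mono_left nhdsWithin_le_nhds
    · filter_upwards [self_mem_nhdsWithin] with h hh
      simpa using hh
  have h3 := ((ContinuousLinearMap.apply 𝕜 X x).continuous.tendsto _).comp (h1.comp h2)
  simpa [expSemigroup, Function.comp_def] using h3

theorem tendsto_expSemigroup_slope_div (B : X →L[𝕜] X) (x : X) {t : ℝ} (ht : 0 < t) :
    Tendsto (fun n : ℕ => (((t / (n + 1 : ℕ) : ℝ) : 𝕜)⁻¹) •
      (expSemigroup B (t / (n + 1 : ℕ)) x - x)) atTop (𝓝 (B x)) := by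
  refine (tendsto_expSemigroup_slope B x).comp (tendsto_nhdsWithin_iff.2 ⟨?_, ?_⟩)
  · exact (tendsto_const_div_atTop_nhds_zero_nat t).comp (tendsto_add_atTop_nat 1)
  · exact Eventually.of_forall fun n => (by positivity : t / ((n + 1 : ℕ) : ℝ) ≠ 0)

variable {p : Seminorm 𝕜 X}

/-- Cut `[0, t]` into `n + 1` equal steps and telescope: the bound is `n + 1` times the difference
after one step, which tends to `t * p (B x - B' x)`. -/
theorem seminorm_expSemigroup_sub_le (hp : Continuous p) {B B' : X →L[𝕜] X} (hBB' : Commute B B')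
    (hB : ∀ t, 0 ≤ t → ∀ x, p (expSemigroup B t x) ≤ p x)
    (hB' : ∀ t, 0 ≤ t → ∀ x, p (expSemigroup B' t x) ≤ p x) {t : ℝ} (ht : 0 ≤ t) (x : X) :
    p (expSemigroup B t x - expSemigroup B' t x) ≤ t * p (B x - B' x) := by
  rcases ht.eq_or_lt with rfl | ht
  · simp
  have hl := ((hp.tendsto _).comp ((tendsto_expSemigroup_slope_div B x ht).sub
    (tendsto_expSemigroup_slope_div B' x ht))).const_mul t
  refine ge_of_tendsto hl (Eventually.of_forall fun n => ?_)
  have hn : (0 : ℝ) < (n + 1 : ℕ) := by positivity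
  have hh : 0 < t / (n + 1 : ℕ) := by positivity
  have hN : ((n + 1 : ℕ) : ℝ) * (t / (n + 1 : ℕ)) = t := by field_simp
  have h1 := seminorm_pow_sub_pow_le (expSemigroup_commute hBB' _ _) (hB _ hh.le) (hB' _ hh.le)
    (n + 1) x
  rw [expSemigroup_pow, expSemigroup_pow, hN] at h1
  refine h1.trans (le_of_eq ?_)
  simp only [Function.comp_apply]
  rw [← smul_sub, ← RCLike.ofReal_inv, seminorm_ofReal_smul p (inv_nonneg.2 hh.le),
    sub_sub_sub_cancel_right]
  field_simp

/-- With step `h`, each telescoped term is `h` times an orbit value of `B x` minus `z`, up to the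
error of the difference quotient; that error vanishes as the mesh shrinks. -/
theorem seminorm_expSemigroup_sub_smul_le (hp : Continuous p) {B : X →L[𝕜] X}
    (hB : ∀ t, 0 ≤ t → ∀ x, p (expSemigroup B t x) ≤ p x) {t ε : ℝ} (ht : 0 ≤ t) (x z : X)
    (hε : ∀ s, 0 ≤ s → s ≤ t → p (expSemigroup B s (B x) - z) ≤ ε) :
    p (expSemigroup B t x - x - (t : 𝕜) • z) ≤ t * ε := by
  rcases ht.eq_or_lt with rfl | ht
  · simp
  have hl := (((hp.tendsto _).comp ((tendsto_expSemigroup_slope_div B x ht).sub_const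
    (B x))).const_mul t).add_const (t * ε)
  simp only [sub_self, map_zero, mul_zero, zero_add] at hl
  refine ge_of_tendsto hl (Eventually.of_forall fun n => ?_)
  have hn : (0 : ℝ) < (n + 1 : ℕ) := by positivity
  obtain ⟨h, rfl⟩ : ∃ h : ℝ, t = (n + 1 : ℕ) * h := ⟨t / (n + 1 : ℕ), by field_simp⟩
  have hh : 0 < h := pos_of_mul_pos_right ht hn.le
  have e1 : ((n + 1 : ℕ) : ℝ) * h / (n + 1 : ℕ) = h := by field_simp
  simp only [Function.comp_apply, e1]
  have h1 := seminorm_pow_sub_nsmul_le (p := p) (expSemigroup B h) ((h : 𝕜) • z) (n + 1) x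
  rw [expSemigroup_pow] at h1
  have e2 : (n + 1) • ((h : 𝕜) • z) = (((((n + 1 : ℕ) : ℝ) * h : ℝ)) : 𝕜) • z := by
    rw [← Nat.cast_smul_eq_nsmul 𝕜, smul_smul]
    congr 1
    push_cast
    rfl
  rw [e2] at h1
  refine h1.trans ?_
  have h2 : ∀ k ∈ Finset.range (n + 1),
      p ((expSemigroup B h ^ k) (expSemigroup B h x - x) - (h : 𝕜) • z)
        ≤ h * p ((h : 𝕜)⁻¹ • (expSemigroup B h x - x) - B x) + h * ε := by
    intro k hk
    have hkn : (k : ℝ) ≤ (n + 1 : ℕ) := by exact_mod_cast (Finset.mem_range.1 hk).le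
    have hne : (h : 𝕜) ≠ 0 := by exact_mod_cast hh.ne'
    set v := (h : 𝕜)⁻¹ • (expSemigroup B h x - x) - B x with hv
    have e3 : (expSemigroup B h ^ k) (expSemigroup B h x - x) - (h : 𝕜) • z
        = (h : 𝕜) • ((expSemigroup B h ^ k) v + ((expSemigroup B h ^ k) (B x) - z)) := by
      rw [← add_sub_assoc, ← map_add, hv, sub_add_cancel, map_smul, smul_sub, smul_smul,
        mul_inv_cancel₀ hne, one_smul]
    rw [e3, seminorm_ofReal_smul p hh.le, ← mul_add]
    have h4 := seminorm_pow_le (hB h hh.le) k v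
    have h5 : p ((expSemigroup B h ^ k) (B x) - z) ≤ ε := by
      rw [expSemigroup_pow]
      exact hε _ (by positivity) (by gcongr)
    gcongr
    exact (map_add_le_add p _ _).trans (add_le_add h4 h5)
  refine (Finset.sum_le_sum h2).trans (le_of_eq ?_)
  rw [Finset.sum_const, Finset.card_range, nsmul_eq_mul]
  ring

/-- If `J` is a `p`-contraction, then so is the semigroup generated by `c (J - 1)`, `c ≥ 0`. -/
theorem seminorm_expSemigroup_le (hp : Continuous p) {J : X →L[𝕜] X} (hJ : ∀ x, p (J x) ≤ p x)
    {c t : ℝ} (hc : 0 ≤ c) (ht : 0 ≤ t) (x : X) :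
    p (expSemigroup ((c : 𝕜) • (J - 1)) t x) ≤ p x := by
  let : NormedAlgebra ℚ (X →L[𝕜] X) := NormedAlgebra.restrictScalars ℚ 𝕜 _
  have ha : 0 ≤ t * c := mul_nonneg ht hc
  set a := t * c with hadef
  -- Bounding the exponential series termwise costs a factor `exp a`, which the scalar part `exp
  -- (-a)` cancels exactly.
  have hJa : ∀ y, p (NormedSpace.exp ((a : 𝕜) • J) y) ≤ Real.exp a * p y := by
    intro y
    have hs := (NormedSpace.exp_series_hasSum_exp' (𝕂 := 𝕜) ((a : 𝕜) • J)).tendsto_sum_nat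
    have hs' := (hp.tendsto _).comp
      (((ContinuousLinearMap.apply 𝕜 X y).continuous.tendsto _).comp hs)
    refine le_of_tendsto hs' (Eventually.of_forall fun N => ?_)
    have hb := Real.sum_le_exp_of_nonneg ha N
    simp only [Function.comp_apply, ContinuousLinearMap.apply_apply]
    calc p ((∑ n ∈ Finset.range N, ((n.factorial : 𝕜)⁻¹ • ((a : 𝕜) • J) ^ n)) y)
        ≤ ∑ n ∈ Finset.range N, a ^ n / n.factorial * p y := by
          rw [sum_apply]
          refine (le_trans (Finset.le_sum_of_subadditive p (map_zero p).le (map_add_le_add p) _ _)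
            (Finset.sum_le_sum fun n _ => ?_))
          rw [smul_pow, smul_apply, smul_apply, smul_smul,
            map_smul_eq_mul, norm_mul, norm_inv, norm_pow, RCLike.norm_ofReal, abs_of_nonneg ha,
            RCLike.norm_natCast, inv_mul_eq_div]
          gcongr
          exact seminorm_pow_le hJ n y
      _ ≤ Real.exp a * p y := by
          rw [← Finset.sum_mul]
          gcongr
  have h1 : NormedSpace.exp (-((a : 𝕜) • (1 : X →L[𝕜] X))) = ((Real.exp (-a) : ℝ) : 𝕜) • 1 := by
    let : NormedAlgebra ℝ (X →L[𝕜] X) := NormedAlgebra.restrictScalars ℝ 𝕜 _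
    have h := NormedSpace.algebraMap_exp_comm (𝕂 := ℝ) (𝔸 := X →L[𝕜] X) (-a)
    rw [← Real.exp_eq_exp_ℝ] at h
    have hal : ∀ r : ℝ, algebraMap ℝ (X →L[𝕜] X) r = (r : 𝕜) • 1 := fun r =>
      Algebra.algebraMap_eq_smul_one (A := X →L[𝕜] X) (r : 𝕜)
    rw [hal, hal, RCLike.ofReal_neg, neg_smul] at h
    exact h.symm
  have e : expSemigroup ((c : 𝕜) • (J - 1)) t x
      = ((Real.exp (-a) : ℝ) : 𝕜) • NormedSpace.exp ((a : 𝕜) • J) x := by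
    have e0 : (t : 𝕜) • ((c : 𝕜) • (J - 1)) = (a : 𝕜) • J + -((a : 𝕜) • (1 : X →L[𝕜] X)) := by
      rw [smul_smul, ← RCLike.ofReal_mul, smul_sub, sub_eq_add_neg]
    rw [expSemigroup, e0, NormedSpace.exp_add_of_commute, h1]
    · simp
    · exact (((Commute.one_right J).smul_left _).smul_right _).neg_right
  rw [e, seminorm_ofReal_smul p (Real.exp_pos _).le]
  calc _ ≤ Real.exp (-a) * (Real.exp a * p x) := by gcongr; exact hJa x
    _ = p x := by rw [← mul_assoc, ← Real.exp_add]; simp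

end ExpSemigroup

/-! ### Convergence with respect to a norming family of seminorms -/

section SeminormLimits

variable {𝕜 X ι : Type*} [RCLike 𝕜] [NormedAddCommGroup X] [NormedSpace 𝕜 X]
  {Γ : Set (Seminorm 𝕜 X)} {l : Filter ι}

/-- `f` tends to `x` along `l` with respect to every seminorm in `Γ`. -/
def SeminormTendsto (Γ : Set (Seminorm 𝕜 X)) (f : ι → X) (l : Filter ι) (x : X) : Prop :=
  ∀ p ∈ Γ, Tendsto (fun i => p (f i - x)) l (𝓝 0)

/-- Every norm-bounded sequence that is Cauchy for every seminorm in `Γ` has a limit. -/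
def BoundedSeqComplete (Γ : Set (Seminorm 𝕜 X)) : Prop :=
  ∀ u : ℕ → X, (∃ C : ℝ, ∀ n, ‖u n‖ ≤ C) →
    (∀ p ∈ Γ, ∀ ε : ℝ, 0 < ε → ∃ N, ∀ m ≥ N, ∀ n ≥ N, p (u m - u n) < ε) →
    ∃ x, SeminormTendsto Γ u atTop x

theorem IsNorming.le_norm (hΓ : IsNorming Γ) {p : Seminorm 𝕜 X} (hp : p ∈ Γ) (x : X) :
    p x ≤ ‖x‖ :=
  (hΓ x).1 ⟨p, hp, rfl⟩

theorem IsNorming.norm_le (hΓ : IsNorming Γ) {x : X} {C : ℝ} (h : ∀ p ∈ Γ, p x ≤ C) : ‖x‖ ≤ C :=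
  (hΓ x).2 (by rintro _ ⟨p, hp, rfl⟩; exact h p hp)

theorem IsNorming.eq_zero (hΓ : IsNorming Γ) {x : X} (h : ∀ p ∈ Γ, p x ≤ 0) : x = 0 :=
  norm_le_zero_iff.1 (hΓ.norm_le h)

theorem IsNorming.continuous (hΓ : IsNorming Γ) {p : Seminorm 𝕜 X} (hp : p ∈ Γ) :
    Continuous p := by
  refine (LipschitzWith.of_dist_le_mul (K := 1) fun x y => ?_).continuous
  rw [Real.dist_eq, dist_eq_norm, NNReal.coe_one, one_mul]
  exact (abs_sub_map_le_sub p x y).trans (hΓ.le_norm hp _)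

theorem seminorm_tendsto_of_tendsto_sub {p : Seminorm 𝕜 X} {f : ι → X} {x : X}
    (h : Tendsto (fun i => p (f i - x)) l (𝓝 0)) : Tendsto (fun i => p (f i)) l (𝓝 (p x)) := by
  rw [tendsto_iff_dist_tendsto_zero]
  exact squeeze_zero (fun _ => dist_nonneg) (fun i => abs_sub_map_le_sub p (f i) x) h

theorem SeminormTendsto.add {f g : ι → X} {x y : X} (hf : SeminormTendsto Γ f l x)
    (hg : SeminormTendsto Γ g l y) : SeminormTendsto Γ (fun i => f i + g i) l (x + y) := by
  intro p hp
  refine squeeze_zero (fun _ => apply_nonneg p _) (fun i => ?_)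
    (by simpa using (hf p hp).add (hg p hp))
  rw [add_sub_add_comm]
  exact map_add_le_add p _ _

theorem SeminormTendsto.smul {f : ι → X} {x : X} (hf : SeminormTendsto Γ f l x) (c : 𝕜) :
    SeminormTendsto Γ (fun i => c • f i) l (c • x) := by
  intro p hp
  simpa [← smul_sub, map_smul_eq_mul] using (hf p hp).const_mul ‖c‖

theorem SeminormTendsto.sub {f g : ι → X} {x y : X} (hf : SeminormTendsto Γ f l x)
    (hg : SeminormTendsto Γ g l y) : SeminormTendsto Γ (fun i => f i - g i) l (x - y) := by
  simpa [sub_eq_add_neg] using hf.add (hg.smul (-1))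

theorem seminormTendsto_const (x : X) : SeminormTendsto Γ (fun _ : ι => x) l x := by
  intro p _
  simpa using tendsto_const_nhds

theorem SeminormTendsto.comp {κ : Type*} {k : Filter κ} {f : ι → X} {x : X} {g : κ → ι}
    (hf : SeminormTendsto Γ f l x) (hg : Tendsto g k l) :
    SeminormTendsto Γ (fun i => f (g i)) k x :=
  fun p hp => (hf p hp).comp hg

theorem SeminormTendsto.seminorm_le [l.NeBot] {f : ι → X} {x : X} (hf : SeminormTendsto Γ f l x)
    {p : Seminorm 𝕜 X} (hp : p ∈ Γ) {C : ℝ} (h : ∀ᶠ i in l, p (f i) ≤ C) : p x ≤ C :=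
  le_of_tendsto (seminorm_tendsto_of_tendsto_sub (hf p hp)) h

theorem SeminormTendsto.unique [l.NeBot] (hΓ : IsNorming Γ) {f : ι → X} {x y : X}
    (hx : SeminormTendsto Γ f l x) (hy : SeminormTendsto Γ f l y) : x = y := by
  have h := hx.sub hy
  refine sub_eq_zero.1 (hΓ.eq_zero fun p hp => h.seminorm_le hp ?_)
  simp

theorem IsGeneratingSystem.tendsto_iff {σ : TopologicalSpace X} (hΓ : IsGeneratingSystem σ Γ)
    {f : ι → X} {x : X} : Tendsto f l (@nhds X σ x) ↔ SeminormTendsto Γ f l x := by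
  rw [@WithSeminorms.tendsto_nhds 𝕜 X ι Γ _ _ _ σ _ hΓ.generates f l x]
  constructor
  · intro h p hp
    rw [Metric.tendsto_nhds]
    intro ε hε
    filter_upwards [h ⟨p, hp⟩ ε hε] with i hi
    rwa [Real.dist_0_eq_abs, abs_of_nonneg (apply_nonneg p _)]
  · intro h p ε hε
    exact (h p p.2).eventually_lt_const hε

theorem IsGeneratingSystem.tendsto_of_le {σ τ : TopologicalSpace X} (hΓ : IsGeneratingSystem σ Γ)
    (hστ : σ ≤ τ) {f : ι → X} {x : X} (h : SeminormTendsto Γ f l x) :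
    Tendsto f l (@nhds X τ x) :=
  (hΓ.tendsto_iff.2 h).mono_right (nhds_mono hστ)

end SeminormLimits

/-! ### What the mixed topology contributes -/

section MixedTopology

variable {𝕜 X ι : Type*} [RCLike 𝕜] [NormedAddCommGroup X] [NormedSpace 𝕜 X]
  {Γ : Set (Seminorm 𝕜 X)} {τ υ : TopologicalSpace X}

theorem IsSaksSpace.isLinearTopology (h : IsSaksSpace 𝕜 τ) : IsLinearTopology 𝕜 τ := by
  obtain ⟨Γ, hΓ, -⟩ := h.norming
  exact ⟨@WithSeminorms.topologicalAddGroup 𝕜 X Γ _ _ _ τ _ hΓ.generates,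
    @WithSeminorms.continuousSMul 𝕜 X Γ _ _ _ τ _ hΓ.generates⟩

/-- The values and the limit lie in one ball, where both topologies induce the same subspace
topology. -/
theorem IsSaksSpace.tendsto_mixedTopology (h : IsSaksSpace 𝕜 τ) {f : ι → X} {l : Filter ι} {x : X}
    (hf : ∃ C : ℝ, ∀ i, ‖f i‖ ≤ C) (hl : Tendsto f l (@nhds X τ x)) :
    Tendsto f l (@nhds X (mixedTopology 𝕜 τ) x) := by
  obtain ⟨C, hC⟩ := hf
  set B : Set X := Metric.closedBall 0 (max C ‖x‖) with hB
  have hx : x ∈ B := by simp [hB]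
  have hfB : ∀ i, f i ∈ B := fun i => by simp [hB, hC i]
  have hind := (isLeast_mixedTopology h.isLinearTopology h.coarser).1.2.2.2 B
    Metric.isBounded_closedBall
  have key : ∀ σ : TopologicalSpace X, Tendsto f l (@nhds X σ x) ↔
      Tendsto (fun i => (⟨f i, hfB i⟩ : B)) l
        (@nhds B (TopologicalSpace.induced ((↑) : B → X) σ) ⟨x, hx⟩) := by
    intro σ
    rw [@nhds_induced X B σ, tendsto_comap_iff]
    rfl
  rw [key, hind, ← key]
  exact hl

theorem seminormTendsto_of_bounded (hτ : IsSaksSpace 𝕜 τ)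
    (hγυ : ∀ (u : ℕ → X) (x : X),
      Tendsto u atTop (@nhds X (mixedTopology 𝕜 τ) x) → Tendsto u atTop (@nhds X υ x))
    (hΓ : IsGeneratingSystem υ Γ) {u : ℕ → X} {x : X} (hu : ∃ C : ℝ, ∀ n, ‖u n‖ ≤ C)
    (h : Tendsto u atTop (@nhds X τ x)) : SeminormTendsto Γ u atTop x :=
  hΓ.tendsto_iff.1 (hγυ u x (hτ.tendsto_mixedTopology hu h))

/-- The double sequence of differences is bounded and tends to `0` for `τ`, hence for the mixed
topology. So the sequence is Cauchy there, and its limit is also a `υ`-limit. -/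
theorem boundedSeqComplete (hτ : IsSeqCompleteSaksSpace 𝕜 τ) (hτυ : υ ≤ τ)
    (hγυ : ∀ (u : ℕ → X) (x : X),
      Tendsto u atTop (@nhds X (mixedTopology 𝕜 τ) x) → Tendsto u atTop (@nhds X υ x))
    (hΓ : IsGeneratingSystem υ Γ) : BoundedSeqComplete Γ := by
  rintro u ⟨C, hC⟩ hu
  have h1 : SeminormTendsto Γ (fun m : ℕ × ℕ => u m.1 - u m.2) (atTop ×ˢ atTop) 0 := by
    intro p hp
    rw [Metric.tendsto_nhds]
    intro ε hε
    obtain ⟨N, hN⟩ := hu p hp ε hε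
    filter_upwards [(eventually_ge_atTop N).prod_mk (eventually_ge_atTop N)] with m hm
    rw [Real.dist_0_eq_abs, abs_of_nonneg (apply_nonneg p _), sub_zero]
    exact hN _ hm.1 _ hm.2
  have h2 : Tendsto (fun m : ℕ × ℕ => u m.1 - u m.2) (atTop ×ˢ atTop) (@nhds X τ 0) :=
    hΓ.tendsto_of_le hτυ h1
  have h3 : ∃ D : ℝ, ∀ m : ℕ × ℕ, ‖u m.1 - u m.2‖ ≤ D :=
    ⟨C + C, fun m => (norm_sub_le _ _).trans (add_le_add (hC m.1) (hC m.2))⟩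
  have h4 : Tendsto (fun m : ℕ × ℕ => u m.1 - u m.2) (atTop ×ˢ atTop)
      (@nhds X (mixedTopology 𝕜 τ) 0) := hτ.saks.tendsto_mixedTopology h3 h2
  obtain ⟨x, hx⟩ := hτ.seqComplete u h4
  exact ⟨x, hΓ.tendsto_iff.1 (hγυ u x hx)⟩

end MixedTopology

/-! ### Resolvents and Yosida approximation of dissipative operators -/

section Resolvent

variable {𝕜 X : Type*} [RCLike 𝕜] [NormedAddCommGroup X] [NormedSpace 𝕜 X]
  {Γ : Set (Seminorm 𝕜 X)} {A : X →ₗ.[𝕜] X}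

/-- `R` is the bounded inverse of `l - A`. -/
structure IsResolvent (A : X →ₗ.[𝕜] X) (l : ℝ) (R : X →L[𝕜] X) : Prop where
  mem : ∀ y, R y ∈ A.domain
  right_inv : ∀ y, (l : 𝕜) • R y - A ⟨R y, mem y⟩ = y
  left_inv : ∀ x : A.domain, R ((l : 𝕜) • (x : X) - A x) = x

theorem IsDissipative.injective (hΓ : IsNorming Γ) (hA : IsDissipative Γ A) {l : ℝ} (hl : 0 < l) :
    Function.Injective (fun x : A.domain => (l : 𝕜) • (x : X) - A x) := by
  intro x y hxy
  have h0 : (l : 𝕜) • ((x - y : A.domain) : X) - A (x - y) = 0 := by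
    have : (l : 𝕜) • (x : X) - A x = (l : 𝕜) • (y : X) - A y := hxy
    rw [LinearPMap.map_sub, Submodule.coe_sub, smul_sub, sub_sub_sub_comm, this, sub_self]
  have h1 : ((x - y : A.domain) : X) = 0 := hΓ.eq_zero fun p hp => by
    have h := hA l hl (x - y) p hp
    rw [h0, map_zero] at h
    exact nonpos_of_mul_nonpos_right h hl
  exact sub_eq_zero.1 (Subtype.ext h1)

theorem IsDissipative.exists_isResolvent (hΓ : IsNorming Γ) (hA : IsDissipative Γ A) {l : ℝ}
    (hl : 0 < l) (hs : Function.Surjective (fun x : A.domain => (l : 𝕜) • (x : X) - A x)) :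
    ∃ R : X →L[𝕜] X, IsResolvent A l R ∧ ∀ p ∈ Γ, ∀ y, l * p (R y) ≤ p y := by
  let L : A.domain →ₗ[𝕜] X := (l : 𝕜) • A.domain.subtype - A.toFun
  have hL : ∀ x, L x = (l : 𝕜) • (x : X) - A x := fun x => rfl
  let e : A.domain ≃ₗ[𝕜] X := LinearEquiv.ofBijective L ⟨hA.injective hΓ hl, hs⟩
  have he : ∀ y, (l : 𝕜) • ((e.symm y : A.domain) : X) - A (e.symm y) = y := fun y =>
    e.apply_symm_apply y
  have hb : ∀ p ∈ Γ, ∀ y, l * p ((e.symm y : A.domain) : X) ≤ p y := fun p hp y => by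
    have h := hA l hl (e.symm y) p hp
    rwa [he] at h
  have hn : ∀ y, ‖(A.domain.subtype ∘ₗ e.symm.toLinearMap) y‖ ≤ l⁻¹ * ‖y‖ := fun y =>
    hΓ.norm_le fun p hp => by
      rw [inv_mul_eq_div, le_div_iff₀' hl]
      exact (hb p hp y).trans (hΓ.le_norm hp y)
  refine ⟨(A.domain.subtype ∘ₗ e.symm.toLinearMap).mkContinuous l⁻¹ hn,
    ⟨fun y => (e.symm y).2, he, fun x => ?_⟩, hb⟩
  exact congrArg Subtype.val (e.symm_apply_apply x)

/-- Since `m - A = (1 - (l - m) R) (l - A)` with `‖R‖ ≤ l⁻¹`, a Neumann series inverts the first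
factor whenever `|l - m| < l`. -/
theorem IsDissipative.surjective_of_lt [CompleteSpace X] (hΓ : IsNorming Γ)
    (hA : IsDissipative Γ A) {l m : ℝ} (hl : 0 < l) (hm : 0 < m) (hml : m < 2 * l)
    (hs : Function.Surjective (fun x : A.domain => (l : 𝕜) • (x : X) - A x)) :
    Function.Surjective (fun x : A.domain => (m : 𝕜) • (x : X) - A x) := by
  obtain ⟨R, hR, hRb⟩ := hA.exists_isResolvent hΓ hl hs
  have hRn : ‖R‖ ≤ l⁻¹ := R.opNorm_le_bound (inv_nonneg.2 hl.le) fun y =>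
    hΓ.norm_le fun p hp => by
      rw [inv_mul_eq_div, le_div_iff₀' hl]
      exact (hRb p hp y).trans (hΓ.le_norm hp y)
  have hlt : ‖((l - m : ℝ) : 𝕜) • R‖ < 1 := by
    rw [norm_smul, RCLike.norm_ofReal]
    calc |l - m| * ‖R‖ ≤ |l - m| * l⁻¹ := by gcongr
      _ < l * l⁻¹ := by
        gcongr
        rw [abs_lt]
        constructor <;> linarith
      _ = 1 := mul_inv_cancel₀ hl.ne'
  obtain ⟨V, hV⟩ := isUnit_one_sub_of_norm_lt_one hlt
  intro z
  obtain ⟨y, hy⟩ : ∃ y, y - ((l - m : ℝ) : 𝕜) • R y = z := by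
    refine ⟨(↑V⁻¹ : X →L[𝕜] X) z, ?_⟩
    have h := congrArg (fun W : X →L[𝕜] X => W z) V.mul_inv
    rw [hV] at h
    simpa using h
  refine ⟨⟨R y, hR.mem y⟩, ?_⟩
  have h := hR.right_inv y
  have h2 : A ⟨R y, hR.mem y⟩ = (l : 𝕜) • R y - y := by
    rw [sub_eq_iff_eq_add.1 h, add_sub_cancel_left]
  simp only [h2]
  rw [← hy, RCLike.ofReal_sub, sub_smul]
  abel

theorem IsDissipative.surjective [CompleteSpace X] (hΓ : IsNorming Γ) (hA : IsDissipative Γ A)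
    {l m : ℝ} (hl : 0 < l) (hm : 0 < m)
    (hs : Function.Surjective (fun x : A.domain => (l : 𝕜) • (x : X) - A x)) :
    Function.Surjective (fun x : A.domain => (m : 𝕜) • (x : X) - A x) := by
  -- Climb by a factor below `2` until `m` is less than twice the current parameter; one last step
  -- then reaches `m`, however small.
  have h : ∀ n : ℕ, Function.Surjective
      (fun x : A.domain => (((3 / 2 : ℝ) ^ n * l : ℝ) : 𝕜) • (x : X) - A x) := by
    intro n
    induction n with
    | zero => simpa using hs
    | succ n ih =>
      have hp : 0 < (3 / 2 : ℝ) ^ n * l := by positivity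
      refine hA.surjective_of_lt hΓ hp (by positivity) ?_ ih
      rw [pow_succ]
      linarith
  obtain ⟨n, hn⟩ := pow_unbounded_of_one_lt (m / (2 * l)) (by norm_num : (1 : ℝ) < 3 / 2)
  refine hA.surjective_of_lt hΓ (by positivity) hm ?_ (h n)
  rw [div_lt_iff₀ (by positivity)] at hn
  linarith

theorem IsResolvent.sub_eq {l m : ℝ} {R S : X →L[𝕜] X} (hR : IsResolvent A l R)
    (hS : IsResolvent A m S) : R - S = ((m - l : ℝ) : 𝕜) • (R * S) := by
  ext y
  have h1 := hS.right_inv y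
  have h2 := hR.left_inv ⟨S y, hS.mem y⟩
  have h3 : y = ((l : 𝕜) • S y - A ⟨S y, hS.mem y⟩) + ((m - l : ℝ) : 𝕜) • S y := by
    rw [RCLike.ofReal_sub, sub_smul]
    nth_rewrite 1 [← h1]
    abel
  have h4 : R y = S y + ((m - l : ℝ) : 𝕜) • R (S y) := by
    nth_rewrite 1 [h3]
    rw [map_add, map_smul, h2]
  simp [h4]

/-- The left side of the resolvent identity is antisymmetric in the two resolvents; compare the
identity with its swapped form. -/
theorem IsResolvent.commute {l m : ℝ} {R S : X →L[𝕜] X} (hR : IsResolvent A l R)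
    (hS : IsResolvent A m S) (hlm : l ≠ m) : Commute R S := by
  have h1 := hR.sub_eq hS
  have h2 := hS.sub_eq hR
  have hne : ((m - l : ℝ) : 𝕜) ≠ 0 := by exact_mod_cast sub_ne_zero.2 hlm.symm
  refine smul_right_injective _ hne ?_
  change ((m - l : ℝ) : 𝕜) • (R * S) = ((m - l : ℝ) : 𝕜) • (S * R)
  rw [← h1, ← neg_sub l m, RCLike.ofReal_neg, neg_smul, ← h2, neg_sub]

theorem IsResolvent.smul_sub_eq {l : ℝ} {R : X →L[𝕜] X} (hR : IsResolvent A l R) (x : A.domain) :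
    (l : 𝕜) • R x - x = R (A x) := by
  have h := hR.left_inv x
  rw [map_sub, map_smul, sub_eq_iff_eq_add] at h
  rw [h, add_sub_cancel_left]

/-- Commuting bounded operators `B n` that generate `Γ`-contraction semigroups and converge to `A`
on its domain. -/
structure IsYosidaApproximation (Γ : Set (Seminorm 𝕜 X)) (A : X →ₗ.[𝕜] X) (B : ℕ → X →L[𝕜] X) :
    Prop where
  contraction : ∀ n (t : ℝ), 0 ≤ t → ∀ p ∈ Γ, ∀ x, p (expSemigroup (B n) t x) ≤ p x
  commute : ∀ m n, Commute (B m) (B n)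
  tendsto : ∀ x : A.domain, SeminormTendsto Γ (fun n => B n x) atTop (A x)
  le : ∀ n (x : A.domain), ∀ p ∈ Γ, p (B n x) ≤ p (A x)

/-- Yosida approximation of a dissipative operator. -/
theorem IsDissipative.exists_yosida [CompleteSpace X] (hΓ : IsNorming Γ) (hA : IsDissipative Γ A)
    (hdense : ∀ x, ∃ u : ℕ → A.domain, SeminormTendsto Γ (fun n => (u n : X)) atTop x)
    {l : ℝ} (hl : 0 < l)
    (hs : Function.Surjective (fun x : A.domain => (l : 𝕜) • (x : X) - A x)) :
    ∃ B : ℕ → X →L[𝕜] X, IsYosidaApproximation Γ A B := by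
  have hc : ∀ n : ℕ, (0 : ℝ) < (n : ℝ) + 1 := fun n => by positivity
  choose R hR hRb using fun n : ℕ =>
    hA.exists_isResolvent hΓ (hc n) (hA.surjective hΓ hl (hc n) hs)
  set J : ℕ → X →L[𝕜] X := fun n => (((n : ℝ) + 1 : ℝ) : 𝕜) • R n with hJ
  have hJp : ∀ n, ∀ p ∈ Γ, ∀ x, p (J n x) ≤ p x := by
    intro n p hp x
    have : p (J n x) = ((n : ℝ) + 1) * p (R n x) := seminorm_ofReal_smul p (hc n).le _
    rw [this]
    exact hRb n p hp x
  have hRcomm : ∀ m n, Commute (R m) (R n) := by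
    intro m n
    by_cases hmn : m = n
    · rw [hmn]
    · refine (hR m).commute (hR n) fun h => hmn ?_
      exact_mod_cast add_right_cancel h
  have hJcomm : ∀ m n, Commute (J m) (J n) := fun m n =>
    ((hRcomm m n).smul_left _).smul_right _
  have hJD : ∀ n (x : A.domain), J n x - x = R n (A x) := fun n x => (hR n).smul_sub_eq x
  -- On `D(A)` the error is `R n (A x)`, of size at most `p (A x) / (n + 1)`. The `J n` are
  -- `p`-contractions, so density gives the rest.
  have hJlim : ∀ x, SeminormTendsto Γ (fun n => J n x) atTop x := by
    intro x p hp
    rw [Metric.tendsto_atTop]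
    intro ε hε
    obtain ⟨u, hu⟩ := hdense x
    obtain ⟨k, hk⟩ := ((hu p hp).eventually_lt_const (by positivity : 0 < ε / 4)).exists
    obtain ⟨N, hN⟩ := exists_nat_gt (p (A (u k)) / (ε / 2))
    refine ⟨N, fun n hn => ?_⟩
    rw [Real.dist_0_eq_abs, abs_of_nonneg (apply_nonneg p _)]
    have e : J n x - x = (J n (x - u k) + (u k - x)) + (J n (u k) - u k) := by
      rw [map_sub]
      abel
    have h1 := map_add_le_add p (J n (x - u k) + (u k - x)) (J n (u k) - u k)
    have h2 := map_add_le_add p (J n (x - u k)) (u k - x)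
    have h3 := hJp n p hp (x - u k)
    rw [map_sub_rev p] at h3
    have h4 : p (J n (u k) - u k) < ε / 2 := by
      rw [hJD]
      have h5 := hRb n p hp (A (u k))
      rw [div_lt_iff₀ (by positivity)] at hN
      have h6 : (N : ℝ) ≤ n := by exact_mod_cast hn
      by_contra hcon
      rw [not_lt] at hcon
      have h7 : (N : ℝ) * (ε / 2) ≤ ((n : ℝ) + 1) * p (R n (A (u k))) := by
        gcongr
        linarith
      linarith
    rw [e]
    linarith
  obtain ⟨B, hB⟩ : ∃ B : ℕ → X →L[𝕜] X, ∀ n, B n = (((n : ℝ) + 1 : ℝ) : 𝕜) • (J n - 1) :=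
    ⟨_, fun _ => rfl⟩
  have hBJ : ∀ n (x : A.domain), B n x = J n (A x) := by
    intro n x
    rw [hB]
    change (((n : ℝ) + 1 : ℝ) : 𝕜) • (J n x - x) = (((n : ℝ) + 1 : ℝ) : 𝕜) • R n (A x)
    rw [hJD]
  refine ⟨B, fun n t ht p hp x => ?_, fun m n => ?_, fun x => ?_, fun n x p hp => ?_⟩
  · rw [hB]
    exact seminorm_expSemigroup_le (hΓ.continuous hp) (hJp n p hp) (hc n).le ht x
  · rw [hB, hB]
    exact ((((hJcomm m n).sub_right (Commute.one_right _)).sub_left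
      ((Commute.one_left _).sub_right (Commute.one_right _))).smul_left _).smul_right _
  · simp only [hBJ]
    exact hJlim _
  · rw [hBJ]
    exact hJp n p hp _

end Resolvent

/-! ### Pointwise limits of contractions -/

section LimitSemigroup

variable {𝕜 X : Type*} [RCLike 𝕜] [NormedAddCommGroup X] [NormedSpace 𝕜 X]
  {Γ : Set (Seminorm 𝕜 X)}

theorem IsNorming.opNorm_le_one (hΓ : IsNorming Γ) {U : X →L[𝕜] X}
    (hU : ∀ p ∈ Γ, ∀ x, p (U x) ≤ p x) : ‖U‖ ≤ 1 :=
  U.opNorm_le_bound zero_le_one fun x => by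
    rw [one_mul]
    exact hΓ.norm_le fun p hp => (hU p hp x).trans (hΓ.le_norm hp x)

/-- A sequence of simultaneous contractions for all seminorms of `Γ` that is Cauchy on a dense
set converges pointwise to a bounded operator. -/
theorem exists_limit_operator (hΓ : IsNorming Γ) (hC : BoundedSeqComplete Γ) {D : Set X}
    (hdense : ∀ x, ∃ u : ℕ → D, SeminormTendsto Γ (fun n => (u n : X)) atTop x)
    {U : ℕ → X →L[𝕜] X} (hU : ∀ n, ∀ p ∈ Γ, ∀ x, p (U n x) ≤ p x)
    (hUD : ∀ x ∈ D, ∀ p ∈ Γ, ∀ ε : ℝ, 0 < ε → ∃ N, ∀ m ≥ N, ∀ n ≥ N, p (U m x - U n x) < ε) :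
    ∃ V : X →L[𝕜] X, ∀ x, SeminormTendsto Γ (fun n => U n x) atTop (V x) := by
  have hex : ∀ x, ∃ y, SeminormTendsto Γ (fun n => U n x) atTop y := by
    intro x
    refine hC _ ⟨‖x‖, fun n => hΓ.norm_le fun p hp => (hU n p hp x).trans (hΓ.le_norm hp x)⟩
      fun p hp ε hε => ?_
    obtain ⟨u, hu⟩ := hdense x
    obtain ⟨k, hk⟩ := ((hu p hp).eventually_lt_const (by positivity : 0 < ε / 4)).exists
    obtain ⟨N, hN⟩ := hUD (u k) (u k).2 p hp (ε / 2) (by positivity)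
    refine ⟨N, fun m hm n hn => ?_⟩
    have e : U m x - U n x = (U n (u k - x) - U m (u k - x)) + (U m (u k) - U n (u k)) := by
      rw [map_sub, map_sub]
      abel
    have h1 := map_add_le_add p (U n (u k - x) - U m (u k - x)) (U m (u k) - U n (u k))
    have h2 := map_sub_le_add p (U n (u k - x)) (U m (u k - x))
    have h3 := hU n p hp (u k - x)
    have h4 := hU m p hp (u k - x)
    have h5 := hN m hm n hn
    rw [e]
    linarith
  choose V hV using hex
  let W : X →ₗ[𝕜] X :=
    { toFun := V
      map_add' := fun x y => (hV (x + y)).unique hΓ (by simpa using (hV x).add (hV y))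
      map_smul' := fun c x => (hV (c • x)).unique hΓ (by simpa using (hV x).smul c) }
  refine ⟨W.mkContinuous 1 fun x => ?_, hV⟩
  rw [one_mul]
  exact hΓ.norm_le fun p hp => (hV x).seminorm_le hp
    (Eventually.of_forall fun n => (hU n p hp x).trans (hΓ.le_norm hp x))

end LimitSemigroup

/-! ### The limit of the Yosida semigroups -/

section YosidaLimit

variable {𝕜 X : Type*} [RCLike 𝕜] [NormedAddCommGroup X] [NormedSpace 𝕜 X]
  {Γ : Set (Seminorm 𝕜 X)} {A : X →ₗ.[𝕜] X} {B : ℕ → X →L[𝕜] X}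

/-- `T` is the pointwise limit of the semigroups generated by `B n`. -/
def IsExpSemigroupLimit (Γ : Set (Seminorm 𝕜 X)) (B : ℕ → X →L[𝕜] X) (T : ℝ≥0 → X →L[𝕜] X) :
    Prop :=
  ∀ (t : ℝ≥0) (x : X), SeminormTendsto Γ (fun n => expSemigroup (B n) (t : ℝ) x) atTop (T t x)

variable {T : ℝ≥0 → X →L[𝕜] X}

theorem IsExpSemigroupLimit.contraction (hT : IsExpSemigroupLimit Γ B T)
    (hB : IsYosidaApproximation Γ A B) (t : ℝ≥0) {p : Seminorm 𝕜 X} (hp : p ∈ Γ) (x : X) :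
    p (T t x) ≤ p x :=
  (hT t x).seminorm_le hp (Eventually.of_forall fun n => hB.contraction n t t.2 p hp x)

theorem IsExpSemigroupLimit.map_zero (hT : IsExpSemigroupLimit Γ B T) (hΓ : IsNorming Γ) (x : X) :
    T 0 x = x :=
  (hT 0 x).unique hΓ (by simpa using seminormTendsto_const x)

variable [CompleteSpace X]

/-- Comparison of the semigroup of `B n` with that of the zero operator. -/
theorem IsYosidaApproximation.seminorm_sub_le (hB : IsYosidaApproximation Γ A B)
    (hΓ : IsNorming Γ) {p : Seminorm 𝕜 X} (hp : p ∈ Γ) (n : ℕ) {t : ℝ} (ht : 0 ≤ t)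
    (x : A.domain) : p (expSemigroup (B n) t x - x) ≤ t * p (A x) := by
  have h := seminorm_expSemigroup_sub_le (hΓ.continuous hp) (Commute.zero_right (B n))
    (fun t ht x => hB.contraction n t ht p hp x) (by simp) ht (x : X)
  simp only [expSemigroup_zero_left, one_apply_eq_self, zero_apply, sub_zero] at h
  exact h.trans (by gcongr; exact hB.le n x p hp)

theorem IsYosidaApproximation.exists_limit (hB : IsYosidaApproximation Γ A B)
    (hΓ : IsNorming Γ) (hC : BoundedSeqComplete Γ)
    (hdense : ∀ x, ∃ u : ℕ → A.domain, SeminormTendsto Γ (fun n => (u n : X)) atTop x) :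
    ∃ T : ℝ≥0 → X →L[𝕜] X, IsExpSemigroupLimit Γ B T := by
  have h : ∀ t : ℝ≥0, ∃ V : X →L[𝕜] X, ∀ x,
      SeminormTendsto Γ (fun n => expSemigroup (B n) (t : ℝ) x) atTop (V x) := by
    intro t
    refine exists_limit_operator hΓ hC (D := A.domain) hdense
      (fun n p hp x => hB.contraction n t t.2 p hp x) fun x hx p hp ε hε => ?_
    -- `t + 1` in place of `t` keeps the denominators positive at `t = 0`.
    have ht : (0 : ℝ) < t + 1 := by positivity
    have hlim := (hB.tendsto ⟨x, hx⟩ p hp).eventually_lt_const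
      (by positivity : 0 < ε / (2 * (t + 1)))
    obtain ⟨N, hN⟩ := eventually_atTop.1 hlim
    refine ⟨N, fun m hm n hn => ?_⟩
    have h1 := seminorm_expSemigroup_sub_le (hΓ.continuous hp) (hB.commute m n)
      (fun t ht x => hB.contraction m t ht p hp x) (fun t ht x => hB.contraction n t ht p hp x)
      t.2 x
    have h2 := map_sub_le_add p (B m x - A ⟨x, hx⟩) (B n x - A ⟨x, hx⟩)
    rw [sub_sub_sub_cancel_right] at h2
    have h3 : p (B m x - B n x) < ε / (t + 1) := by
      have e : ε / (t + 1) = ε / (2 * (t + 1)) + ε / (2 * (t + 1)) := by field_simp; ring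
      rw [e]
      exact h2.trans_lt (add_lt_add (hN m hm) (hN n hn))
    rw [lt_div_iff₀ ht] at h3
    have h4 := apply_nonneg p (B m x - B n x)
    refine h1.trans_lt ?_
    rw [NNReal.val_eq_coe]
    linarith
  choose T hT using h
  exact ⟨T, hT⟩

theorem IsExpSemigroupLimit.map_add (hT : IsExpSemigroupLimit Γ B T)
    (hB : IsYosidaApproximation Γ A B) (hΓ : IsNorming Γ) (t s : ℝ≥0) (x : X) :
    T (t + s) x = T t (T s x) := by
  have h1 : SeminormTendsto Γ (fun n => expSemigroup (B n) t (expSemigroup (B n) s x - T s x))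
      atTop 0 := by
    intro p hp
    refine squeeze_zero (fun _ => apply_nonneg p _) (fun n => ?_) (hT s x p hp)
    rw [sub_zero]
    exact hB.contraction n t t.2 p hp _
  have h2 := h1.add (hT t (T s x))
  rw [zero_add] at h2
  refine (hT (t + s) x).unique hΓ ?_
  convert h2 using 2 with n
  rw [NNReal.coe_add, expSemigroup_add, map_sub, sub_add_cancel]
  rfl

theorem IsExpSemigroupLimit.seminorm_sub_le (hT : IsExpSemigroupLimit Γ B T)
    (hB : IsYosidaApproximation Γ A B) (hΓ : IsNorming Γ) {p : Seminorm 𝕜 X} (hp : p ∈ Γ)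
    (t : ℝ≥0) (x : A.domain) : p (T t x - x) ≤ t * p (A x) :=
  ((hT t x).sub (seminormTendsto_const _)).seminorm_le hp
    (Eventually.of_forall fun n => hB.seminorm_sub_le hΓ hp n t.2 x)

/-- The point is that `δ` does not depend on `n`: it is read off from one element of `D(A)` close to
`x`, where `p (B n _) ≤ p (A _)`. -/
theorem IsExpSemigroupLimit.exists_seminorm_sub_le (hT : IsExpSemigroupLimit Γ B T)
    (hB : IsYosidaApproximation Γ A B) (hΓ : IsNorming Γ)
    (hdense : ∀ x, ∃ u : ℕ → A.domain, SeminormTendsto Γ (fun n => (u n : X)) atTop x)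
    {p : Seminorm 𝕜 X} (hp : p ∈ Γ) (x : X) {ε : ℝ} (hε : 0 < ε) :
    ∃ δ : ℝ, 0 < δ ∧ ∀ t : ℝ≥0, (t : ℝ) ≤ δ → p (T t x - x) ≤ ε ∧
      ∀ n, p (expSemigroup (B n) t x - x) ≤ ε := by
  obtain ⟨u, hu⟩ := hdense x
  obtain ⟨k, hk⟩ := ((hu p hp).eventually_lt_const (by positivity : 0 < ε / 4)).exists
  refine ⟨ε / (2 * (p (A (u k)) + 1)), by positivity, fun t ht => ?_⟩
  rw [le_div_iff₀ (by positivity)] at ht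
  have key : ∀ n, p (expSemigroup (B n) t x - x) ≤ ε := by
    intro n
    have e : expSemigroup (B n) t x - x = ((u k - x) - expSemigroup (B n) t (u k - x))
        + (expSemigroup (B n) t (u k) - u k) := by
      rw [map_sub]
      abel
    have h1 := map_add_le_add p ((u k - x) - expSemigroup (B n) t (u k - x))
      (expSemigroup (B n) t (u k) - u k)
    have h2 := map_sub_le_add p (u k - x) (expSemigroup (B n) t (u k - x))
    have h3 : p (expSemigroup (B n) (t : ℝ) (u k - x)) ≤ p (u k - x) :=
      hB.contraction n t t.2 p hp (u k - x)
    have h4 : p (expSemigroup (B n) (t : ℝ) (u k) - u k) ≤ (t : ℝ) * p (A (u k)) :=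
      hB.seminorm_sub_le hΓ hp n t.2 (u k)
    have h5 : (0 : ℝ) ≤ t := t.2
    rw [e]
    linarith
  exact ⟨((hT t x).sub (seminormTendsto_const _)).seminorm_le hp (Eventually.of_forall key), key⟩

/-- Differentiability at `0`, obtained for the approximants and passed to the limit. The orbit of `B
n x` stays near `A x` for short times: half of `ε` pays for `B n x → A x`, half for the continuity
at `0` of the orbits of `A x`, uniform in `n`. -/
theorem IsExpSemigroupLimit.exists_seminorm_sub_smul_le (hT : IsExpSemigroupLimit Γ B T)
    (hB : IsYosidaApproximation Γ A B) (hΓ : IsNorming Γ)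
    (hdense : ∀ x, ∃ u : ℕ → A.domain, SeminormTendsto Γ (fun n => (u n : X)) atTop x)
    {p : Seminorm 𝕜 X} (hp : p ∈ Γ) (x : A.domain) {ε : ℝ} (hε : 0 < ε) :
    ∃ δ : ℝ, 0 < δ ∧ ∀ t : ℝ≥0, (t : ℝ) ≤ δ → p (T t x - x - ((t : ℝ) : 𝕜) • A x) ≤ t * ε := by
  obtain ⟨δ, hδ, h⟩ := hT.exists_seminorm_sub_le hB hΓ hdense hp (A x)
    (by positivity : 0 < ε / 2)
  refine ⟨δ, hδ, fun t ht => ?_⟩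
  refine (((hT t x).sub (seminormTendsto_const _)).sub (seminormTendsto_const _)).seminorm_le hp ?_
  filter_upwards [(hB.tendsto x p hp).eventually_lt_const (by positivity : 0 < ε / 2)] with n hn
  refine seminorm_expSemigroup_sub_smul_le (hΓ.continuous hp)
    (fun t ht x => hB.contraction n t ht p hp x) t.2 _ _ fun s hs hst => ?_
  have e : expSemigroup (B n) s (B n x) - A x = expSemigroup (B n) s (B n x - A x)
      + (expSemigroup (B n) s (A x) - A x) := by
    rw [map_sub]
    abel
  have h1 := hB.contraction n s hs p hp (B n x - A x)
  have h2 := (h ⟨s, hs⟩ (hst.trans ht)).2 n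
  rw [e]
  refine (map_add_le_add p _ _).trans ?_
  change p (expSemigroup (B n) s (A x) - A x) ≤ ε / 2 at h2
  linarith

theorem IsExpSemigroupLimit.seminormTendsto (hT : IsExpSemigroupLimit Γ B T)
    (hB : IsYosidaApproximation Γ A B) (hΓ : IsNorming Γ)
    (hdense : ∀ x, ∃ u : ℕ → A.domain, SeminormTendsto Γ (fun n => (u n : X)) atTop x)
    (x : X) (t : ℝ≥0) : SeminormTendsto Γ (fun s => T s x) (𝓝 t) (T t x) := by
  intro p hp
  rw [Metric.tendsto_nhds_nhds]
  intro ε hε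
  obtain ⟨δ, hδ, h⟩ := hT.exists_seminorm_sub_le hB hΓ hdense hp x (by positivity : 0 < ε / 2)
  -- Pulling out the contraction at the earlier time reduces continuity from either side to
  -- continuity at `0`.
  have key : ∀ r s : ℝ≥0, r ≤ s → dist s r < δ → p (T s x - T r x) < ε := by
    intro r s hrs hd
    have hd' : ((s - r : ℝ≥0) : ℝ) ≤ δ := by
      rw [NNReal.dist_eq] at hd
      rw [NNReal.coe_sub hrs]
      exact (le_abs_self _).trans hd.le
    have e : T s x - T r x = T r (T (s - r) x - x) := by
      rw [map_sub, ← hT.map_add hB hΓ, add_tsub_cancel_of_le hrs]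
    rw [e]
    exact ((hT.contraction hB r hp _).trans (h _ hd').1).trans_lt (by linarith)
  refine ⟨δ, hδ, fun s hd => ?_⟩
  rw [Real.dist_0_eq_abs, abs_of_nonneg (apply_nonneg p _)]
  rcases le_total t s with hts | hst
  · exact key t s hts hd
  · rw [map_sub_rev]
    exact key s t hst (by rwa [dist_comm])

theorem IsExpSemigroupLimit.seminormTendsto_slope (hT : IsExpSemigroupLimit Γ B T)
    (hB : IsYosidaApproximation Γ A B) (hΓ : IsNorming Γ)
    (hdense : ∀ x, ∃ u : ℕ → A.domain, SeminormTendsto Γ (fun n => (u n : X)) atTop x)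
    (x : A.domain) : SeminormTendsto Γ
      (fun t : ℝ≥0 => (((t : ℝ) : 𝕜)⁻¹) • (T t x - x)) (𝓝[>] 0) (A x) := by
  intro p hp
  rw [Metric.tendsto_nhdsWithin_nhds]
  intro ε hε
  obtain ⟨δ, hδ, h⟩ := hT.exists_seminorm_sub_smul_le hB hΓ hdense hp x
    (by positivity : 0 < ε / 2)
  refine ⟨δ, hδ, fun t ht hd => ?_⟩
  have ht0 : (0 : ℝ) < t := ht
  have hne : ((t : ℝ) : 𝕜) ≠ 0 := by exact_mod_cast ht0.ne'
  have htd : (t : ℝ) ≤ δ := by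
    rw [NNReal.dist_eq, NNReal.coe_zero, sub_zero] at hd
    exact (le_abs_self _).trans hd.le
  have e : (((t : ℝ) : 𝕜)⁻¹) • (T t x - x) - A x
      = ((((t : ℝ)⁻¹ : ℝ)) : 𝕜) • (T t x - x - ((t : ℝ) : 𝕜) • A x) := by
    rw [RCLike.ofReal_inv, smul_sub _ _ (((t : ℝ) : 𝕜) • A x), smul_smul, inv_mul_cancel₀ hne,
      one_smul]
  rw [Real.dist_0_eq_abs, abs_of_nonneg (apply_nonneg p _), e,
    seminorm_ofReal_smul p (inv_nonneg.2 ht0.le), inv_mul_lt_iff₀ ht0]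
  refine (h t htd).trans_lt ?_
  gcongr
  linarith

end YosidaLimit

/-! ### Difference quotients and dissipativity -/

section Generator

variable {𝕜 X : Type*} [RCLike 𝕜] [NormedAddCommGroup X] [NormedSpace 𝕜 X]
  {Γ : Set (Seminorm 𝕜 X)} {T : ℝ≥0 → X →L[𝕜] X}

theorem tendsto_inv_natCast_add_one_nhdsGT :
    Tendsto (fun n : ℕ => ((n : ℝ≥0) + 1)⁻¹) atTop (𝓝[>] (0 : ℝ≥0)) := by
  refine tendsto_nhdsWithin_iff.2 ⟨?_, Eventually.of_forall fun n => ?_⟩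
  · rw [← NNReal.tendsto_coe]
    simpa using tendsto_one_div_add_atTop_nhds_zero_nat (𝕜 := ℝ)
  · exact (by positivity : (0 : ℝ≥0) < ((n : ℝ≥0) + 1)⁻¹)

/-- With `r = 1 / t`, the vector `(c + r) x - r T(t) x` has seminorm at least `(c + r) p x - r p x =
c p x`; then pass to the limit. No operator `A` appears, so the bound also applies to slope limits
not yet known to be values of `A`. -/
theorem seminorm_smul_sub_ge_of_slope {ι : Type*} {l : Filter ι} [l.NeBot] {t : ι → ℝ≥0}
    (ht : ∀ i, 0 < t i) {p : Seminorm 𝕜 X} (hT : ∀ t x, p (T t x) ≤ p x) {x y : X}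
    (h : Tendsto (fun i => p ((((t i : ℝ) : 𝕜)⁻¹) • (T (t i) x - x) - y)) l (𝓝 0))
    {c : ℝ} (hc : 0 < c) : c * p x ≤ p ((c : 𝕜) • x - y) := by
  have h1 : Tendsto (fun i => p (((c : 𝕜) • x - (((t i : ℝ) : 𝕜)⁻¹) • (T (t i) x - x))
      - ((c : 𝕜) • x - y))) l (𝓝 0) := by
    refine h.congr fun i => ?_
    rw [sub_sub_sub_cancel_left, map_sub_rev]
  refine ge_of_tendsto (seminorm_tendsto_of_tendsto_sub h1) (Eventually.of_forall fun i => ?_)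
  have hr : (0 : ℝ) < (t i : ℝ)⁻¹ := inv_pos.2 (ht i)
  rw [← RCLike.ofReal_inv]
  set r := (t i : ℝ)⁻¹
  have e : (c : 𝕜) • x - (r : 𝕜) • (T (t i) x - x)
      = ((c + r : ℝ) : 𝕜) • x - (r : 𝕜) • T (t i) x := by
    rw [RCLike.ofReal_add, add_smul, smul_sub]
    abel
  have h2 := (le_abs_self _).trans (abs_sub_map_le_sub p (((c + r : ℝ) : 𝕜) • x) ((r : 𝕜) • T (t i) x))
  rw [seminorm_ofReal_smul p (by positivity), seminorm_ofReal_smul p hr.le] at h2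
  have h3 := mul_le_mul_of_nonneg_left (hT (t i) x) hr.le
  rw [e]
  linarith

end Generator

/-! ### From dissipativity and range condition to the semigroup -/

section LumerPhillips

variable {𝕜 X : Type*} [RCLike 𝕜] [NormedAddCommGroup X] [NormedSpace 𝕜 X]
  {Γ : Set (Seminorm 𝕜 X)} {A : X →ₗ.[𝕜] X} {T : ℝ≥0 → X →L[𝕜] X} {τ υ : TopologicalSpace X}

/-- `τ`-convergent norm-bounded sequences converge for every seminorm in `Γ`. -/
def BoundedSeqContinuous (τ : TopologicalSpace X) (Γ : Set (Seminorm 𝕜 X)) : Prop :=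
  ∀ (u : ℕ → X) (x : X), (∃ C : ℝ, ∀ n, ‖u n‖ ≤ C) → Tendsto u atTop (@nhds X τ x) →
    SeminormTendsto Γ u atTop x

/-- The upgrade from `τ` to `Γ` concerns bounded sequences only, hence the times `1 / (n + 1)`; the
boundedness clause in the generator's domain supplies the bound. -/
theorem BoundedSeqContinuous.seminormTendsto_slope (hτ : BoundedSeqContinuous τ Γ) {x y : X}
    (h : Tendsto (fun t : ℝ≥0 => (((t : ℝ) : 𝕜)⁻¹) • (T t x - x)) (𝓝[>] 0) (@nhds X τ y))
    (hC : ∃ C : ℝ, ∀ t : ℝ≥0, 0 < t → t ≤ 1 → ‖T t x - x‖ / t ≤ C) :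
    SeminormTendsto Γ (fun n : ℕ => ((((((n : ℝ≥0) + 1)⁻¹ : ℝ≥0) : ℝ) : 𝕜)⁻¹) •
      (T ((n : ℝ≥0) + 1)⁻¹ x - x)) atTop y := by
  obtain ⟨C, hC⟩ := hC
  refine hτ _ _ ⟨C, fun n => ?_⟩ (h.comp tendsto_inv_natCast_add_one_nhdsGT)
  have h1 : (0 : ℝ≥0) < ((n : ℝ≥0) + 1)⁻¹ := by positivity
  have h2 : ((n : ℝ≥0) + 1)⁻¹ ≤ 1 := inv_le_one_of_one_le₀ (by simp)
  rw [norm_smul, norm_inv, RCLike.norm_ofReal, abs_of_nonneg (NNReal.coe_nonneg _),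
    inv_mul_eq_div]
  exact hC _ h1 h2

theorem IsGenerator.isDissipative (hA : IsGenerator T τ A) (hτ : BoundedSeqContinuous τ Γ)
    (hT : ∀ t : ℝ≥0, ∀ p ∈ Γ, ∀ x, p (T t x) ≤ p x) : IsDissipative Γ A := by
  intro c hc x p hp
  obtain ⟨h1, h2⟩ := (hA x (A x)).1 ⟨x.2, rfl⟩
  exact seminorm_smul_sub_ge_of_slope (fun n => by positivity) (fun t x => hT t p hp x)
    (hτ.seminormTendsto_slope h1 h2 p hp) hc

/-- The semigroup generated by a dissipative operator with a surjective `l - A`. -/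
theorem IsDissipative.exists_semigroup [CompleteSpace X] (hA : IsDissipative Γ A)
    (hΓ : IsNorming Γ) (hυ : IsGeneratingSystem υ Γ) (hυτ : υ ≤ τ)
    (hτ : BoundedSeqContinuous τ Γ) (hC : BoundedSeqComplete Γ) (hd : IsBiDenselyDefined τ A)
    {l : ℝ} (hl : 0 < l)
    (hs : Function.Surjective (fun x : A.domain => (l : 𝕜) • (x : X) - A x)) :
    ∃ T : ℝ≥0 → BoundedOperator 𝕜 X, IsBiContinuousSemigroup T τ ∧ IsContraction T ∧ IsGenerator T τ A ∧
      ∀ t : ℝ≥0, ∀ p ∈ Γ, ∀ x : X, p (T t x) ≤ p x := by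
  have hdense : ∀ x, ∃ u : ℕ → A.domain, SeminormTendsto Γ (fun n => (u n : X)) atTop x := by
    intro x
    obtain ⟨u, hu, hb, ht⟩ := hd x
    exact ⟨fun n => ⟨u n, hu n⟩, hτ u x hb ht⟩
  obtain ⟨B, hB⟩ := hA.exists_yosida hΓ hdense hl hs
  obtain ⟨T, hT⟩ := hB.exists_limit hΓ hC hdense
  have hTp : ∀ t : ℝ≥0, ∀ p ∈ Γ, ∀ x : X, p (T t x) ≤ p x := fun t p hp x =>
    hT.contraction hB t hp x
  have hT1 : IsContraction T := fun t => hΓ.opNorm_le_one (hTp t)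
  have hgen : ∀ x : A.domain,
      Tendsto (fun t : ℝ≥0 => (((t : ℝ) : 𝕜)⁻¹) • (T t x - x)) (𝓝[>] 0) (@nhds X τ (A x)) ∧
      ∃ C : ℝ, ∀ t : ℝ≥0, 0 < t → t ≤ 1 → ‖T t x - x‖ / t ≤ C := by
    refine fun x => ⟨hυ.tendsto_of_le hυτ (hT.seminormTendsto_slope hB hΓ hdense x),
      ‖A x‖, fun t ht _ => ?_⟩
    have ht' : (0 : ℝ) < t := ht
    rw [div_le_iff₀ ht', mul_comm]
    exact hΓ.norm_le fun p hp => (hT.seminorm_sub_le hB hΓ hp t x).trans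
      (by gcongr; exact hΓ.le_norm hp _)
  refine ⟨T, ⟨hT.map_zero hΓ, hT.map_add hB hΓ, fun x => ?_, ⟨1, 0, le_rfl, fun t => ?_⟩, ?_⟩,
    hT1, fun x y => ⟨?_, ?_⟩, hTp⟩
  · refine (@continuous_iff_continuousAt ℝ≥0 X _ τ _).2 fun t => ?_
    exact hυ.tendsto_of_le hυτ (hT.seminormTendsto hB hΓ hdense x t)
  · simpa using hT1 t
  · intro u x hb hu t₀ U hU
    -- Uniformity over `[0, t₀]` is expressed as convergence along a product with a principal
    -- filter.
    have h1 : SeminormTendsto Γ (fun q : ℕ × ℝ≥0 => T q.2 (u q.1 - x))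
        (atTop ×ˢ 𝓟 (Set.Iic t₀)) 0 := by
      intro p hp
      refine squeeze_zero (fun _ => apply_nonneg p _) (fun q => ?_)
        ((hτ u x hb hu p hp).comp tendsto_fst)
      rw [sub_zero]
      exact hTp _ p hp _
    have h2 := (hυ.tendsto_of_le hυτ h1).eventually hU
    rw [eventually_prod_principal_iff] at h2
    exact h2
  · rintro ⟨hx, rfl⟩
    exact hgen ⟨x, hx⟩
  · rintro ⟨h1, h2⟩
    -- Maximality: the range condition gives `x' ∈ D(A)` with `(l - A) x' = l x - y`, and the slope
    -- estimate applied to `x - x'` forces `x = x'`.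
    obtain ⟨x', hx'⟩ := hs ((l : 𝕜) • x - y)
    have h3 := (hτ.seminormTendsto_slope h1 h2).sub
      (hτ.seminormTendsto_slope (hgen x').1 (hgen x').2)
    have h0 : (l : 𝕜) • (x - x') - (y - A x') = 0 := by
      have hx'' : (l : 𝕜) • (x' : X) - A x' = (l : 𝕜) • x - y := hx'
      rw [smul_sub, sub_sub_sub_comm, hx'', sub_self]
    have hw : x - x' = 0 := hΓ.eq_zero fun p hp => by
      have h5 := seminorm_smul_sub_ge_of_slope (T := T) (x := x - x') (y := y - A x')
        (t := fun n : ℕ => ((n : ℝ≥0) + 1)⁻¹) (fun n => by positivity)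
        (fun t x => hTp t p hp x) (by
          refine (h3 p hp).congr fun n => ?_
          beta_reduce
          rw [← smul_sub, map_sub (T _), sub_sub_sub_comm (T _ x)]) hl
      rw [h0, map_zero] at h5
      exact nonpos_of_mul_nonpos_right h5 hl
    have hxx : x = x' := sub_eq_zero.1 hw
    refine ⟨hxx ▸ x'.2, ?_⟩
    have hxx' : x' = ⟨x, hxx ▸ x'.2⟩ := Subtype.ext hxx.symm
    rw [hw, smul_zero, zero_sub, neg_eq_zero, sub_eq_zero] at h0
    rw [h0, ← hxx']

end LumerPhillips

/-! ### Riemann sums for the integral of a decaying semigroup -/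

section DiscreteResolvent

variable {𝕜 X : Type*} [RCLike 𝕜] [NormedAddCommGroup X] [NormedSpace 𝕜 X]
  {Γ : Set (Seminorm 𝕜 X)} {S : ℝ≥0 → X →L[𝕜] X}

theorem SeminormTendsto.smul_of_tendsto {ι : Type*} {l : Filter ι} {f : ι → X} {x : X} {c : ι → ℝ}
    {r : ℝ} (hf : SeminormTendsto Γ f l x) (hc : Tendsto c l (𝓝 r)) :
    SeminormTendsto Γ (fun i => (c i : 𝕜) • f i) l ((r : 𝕜) • x) := by
  intro p hp
  have h1 : Tendsto (fun i => |c i| * p (f i - x) + |c i - r| * p x) l (𝓝 0) := by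
    have h2 := (hc.sub_const r).abs
    simpa using (hc.abs.mul (hf p hp)).add (h2.mul_const (p x))
  refine squeeze_zero (fun _ => apply_nonneg p _) (fun i => ?_) h1
  have e : (c i : 𝕜) • f i - (r : 𝕜) • x
      = (c i : 𝕜) • (f i - x) + ((c i - r : ℝ) : 𝕜) • x := by
    rw [RCLike.ofReal_sub, sub_smul, smul_sub]
    abel
  rw [e]
  refine (map_add_le_add p _ _).trans (le_of_eq ?_)
  rw [map_smul_eq_mul, map_smul_eq_mul, RCLike.norm_ofReal, RCLike.norm_ofReal]

/-- A semigroup that decays like `exp (-t)` for all seminorms of `Γ` and is `Γ`-strongly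
continuous. -/
structure IsDecayingSemigroup (Γ : Set (Seminorm 𝕜 X)) (S : ℝ≥0 → X →L[𝕜] X) : Prop where
  map_zero : S 0 = 1
  map_add : ∀ t s, S (t + s) = S t * S s
  decay : ∀ t : ℝ≥0, ∀ p ∈ Γ, ∀ x, p (S t x) ≤ Real.exp (-t) * p x
  continuous : ∀ x t, SeminormTendsto Γ (fun s => S s x) (𝓝 t) (S t x)

theorem IsDecayingSemigroup.contraction (hS : IsDecayingSemigroup Γ S) (t : ℝ≥0)
    {p : Seminorm 𝕜 X} (hp : p ∈ Γ) (x : X) : p (S t x) ≤ p x :=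
  (hS.decay t p hp x).trans (mul_le_of_le_one_left (apply_nonneg p x)
    (Real.exp_le_one_iff.2 (neg_nonpos.2 t.2)))

theorem IsDecayingSemigroup.pow (hS : IsDecayingSemigroup Γ S) (t : ℝ≥0) (n : ℕ) :
    S t ^ n = S (n * t) := by
  induction n with
  | zero => simp [hS.map_zero]
  | succ n ih => rw [pow_succ, ih, ← hS.map_add]; congr 1; push_cast; ring

/-- `R` is `h (1 - S h)⁻¹`. -/
structure IsDiscreteResolvent (S : ℝ≥0 → X →L[𝕜] X) (h : ℝ≥0) (R : X →L[𝕜] X) : Prop where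
  right_inv : ∀ x, R x - S h (R x) = ((h : ℝ) : 𝕜) • x
  left_inv : ∀ x, R (x - S h x) = ((h : ℝ) : 𝕜) • x

/-- Decay and the norming property give `‖S h‖ ≤ exp (-h) < 1`, so the Neumann series converges. -/
theorem IsDecayingSemigroup.exists_isDiscreteResolvent [CompleteSpace X]
    (hS : IsDecayingSemigroup Γ S) (hΓ : IsNorming Γ) {h : ℝ≥0} (hh : 0 < h) :
    ∃ R : X →L[𝕜] X, IsDiscreteResolvent S h R := by
  have hlt : ‖S h‖ < 1 := by
    have h1 : ‖S h‖ ≤ Real.exp (-h) := (S h).opNorm_le_bound (Real.exp_pos _).le fun x =>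
      hΓ.norm_le fun p hp => (hS.decay h p hp x).trans (by gcongr; exact hΓ.le_norm hp x)
    exact h1.trans_lt (by simpa using hh)
  obtain ⟨V, hV⟩ := isUnit_one_sub_of_norm_lt_one hlt
  refine ⟨((h : ℝ) : 𝕜) • (↑V⁻¹ : X →L[𝕜] X), fun x => ?_, fun x => ?_⟩
  · have h1 := congrArg (fun W : X →L[𝕜] X => ((h : ℝ) : 𝕜) • W x) V.mul_inv
    rw [hV] at h1
    simpa [smul_sub] using h1
  · have h1 := congrArg (fun W : X →L[𝕜] X => ((h : ℝ) : 𝕜) • W x) V.inv_mul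
    rw [hV] at h1
    simpa [smul_sub] using h1

/-- The bound is uniform in the step: `R x = h x + S h (R x)`, and `exp (-h) ≤ 1 - h / 2` on `[0,
1]` produces the constant `2`. -/
theorem IsDiscreteResolvent.seminorm_le {h : ℝ≥0} {R : X →L[𝕜] X}
    (hR : IsDiscreteResolvent S h R) (hS : IsDecayingSemigroup Γ S) (hh : 0 < h) (hh1 : h ≤ 1)
    {p : Seminorm 𝕜 X} (hp : p ∈ Γ) (x : X) : p (R x) ≤ 2 * p x := by
  have h0 : (0 : ℝ) < h := hh
  have h1 : (h : ℝ) ≤ 1 := hh1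
  have e : R x = ((h : ℝ) : 𝕜) • x + S h (R x) := by
    rw [← hR.right_inv x, sub_add_cancel]
  have h2 : p (R x) ≤ h * p x + Real.exp (-h) * p (R x) := by
    calc p (R x) = p (((h : ℝ) : 𝕜) • x + S h (R x)) := congrArg p e
      _ ≤ p (((h : ℝ) : 𝕜) • x) + p (S h (R x)) := map_add_le_add p _ _
      _ ≤ h * p x + Real.exp (-h) * p (R x) := by
        rw [seminorm_ofReal_smul p h0.le]
        gcongr
        exact hS.decay h p hp _
  have h3 : Real.exp (-(h : ℝ)) ≤ 1 - h / 2 := by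
    rw [Real.exp_neg, inv_le_iff_one_le_mul₀ (Real.exp_pos _)]
    nlinarith [Real.add_one_le_exp (h : ℝ)]
  have h4 : Real.exp (-(h : ℝ)) * p (R x) ≤ (1 - h / 2) * p (R x) := by gcongr
  have h5 : (h : ℝ) * p (R x) ≤ h * (2 * p x) := by linarith
  exact le_of_mul_le_mul_left h5 h0

/-- Refining the mesh `m` times: factoring `1 - S g ^ m` gives `m (Q x - R x) = R (∑ (S (i g) x -
x))`, a sum of `m` terms each at most `ε`. -/
theorem IsDiscreteResolvent.seminorm_sub_le {g : ℝ≥0} {m : ℕ} (hm : 0 < m) (hg : 0 < g)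
    {R Q : X →L[𝕜] X} (hQ : IsDiscreteResolvent S g Q) (hR : IsDiscreteResolvent S (m * g) R)
    (hS : IsDecayingSemigroup Γ S) (hmg : m * g ≤ 1)
    {p : Seminorm 𝕜 X} (hp : p ∈ Γ) {x : X} {ε : ℝ}
    (hε : ∀ r ≤ m * g, p (S r x - x) ≤ ε) : p (Q x - R x) ≤ 2 * ε := by
  have hm' : (0 : ℝ) < m := by exact_mod_cast hm
  have hg' : (0 : ℝ) < g := hg
  have hmk : (m : 𝕜) ≠ 0 := by exact_mod_cast hm.ne'
  have hgk : ((g : ℝ) : 𝕜) ≠ 0 := by exact_mod_cast hg'.ne'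
  have h1 : Q x - S (m * g) (Q x)
      = ((g : ℝ) : 𝕜) • ∑ i ∈ Finset.range m, (S g ^ i) x := by
    have h2 := congrArg (fun W : X →L[𝕜] X => W (Q x)) (geom_sum_mul_neg (S g) m)
    rw [hS.pow] at h2
    have h3 : (∑ i ∈ Finset.range m, S g ^ i) (Q x - S g (Q x)) = Q x - S (m * g) (Q x) := h2
    rw [← h3, hQ.right_inv, map_smul, sum_apply]
  have h4 := hR.left_inv (Q x)
  rw [h1, map_smul, NNReal.coe_mul, NNReal.coe_natCast, RCLike.ofReal_mul, RCLike.ofReal_natCast,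
    mul_comm, mul_smul] at h4
  have h5 := smul_right_injective X hgk h4
  have h6 : (m : 𝕜) • (Q x - R x) = R (∑ i ∈ Finset.range m, ((S g ^ i) x - x)) := by
    rw [Finset.sum_sub_distrib, map_sub, h5, Finset.sum_const, Finset.card_range, map_nsmul,
      smul_sub, Nat.cast_smul_eq_nsmul 𝕜 m (R x)]
  have h7 : (m : ℝ) * p (Q x - R x) ≤ m * (2 * ε) := by
    calc (m : ℝ) * p (Q x - R x) = p ((m : 𝕜) • (Q x - R x)) := by
          rw [map_smul_eq_mul, RCLike.norm_natCast]
      _ ≤ 2 * p (∑ i ∈ Finset.range m, ((S g ^ i) x - x)) := by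
          rw [h6]
          exact hR.seminorm_le hS (mul_pos (by exact_mod_cast hm) hg) hmg hp _
      _ ≤ 2 * ∑ i ∈ Finset.range m, ε := by
          gcongr
          refine (Finset.le_sum_of_subadditive p (map_zero p).le (map_add_le_add p) _ _).trans
            (Finset.sum_le_sum fun i hi => ?_)
          rw [hS.pow]
          refine hε _ ?_
          gcongr
          exact (Finset.mem_range.1 hi).le
      _ = m * (2 * ε) := by
          rw [Finset.sum_const, Finset.card_range, nsmul_eq_mul]
          ring
  exact le_of_mul_le_mul_left h7 hm'

/-- One step moves `R x` by `-h x`, so `k` steps move it by `-h ∑ S (i h) x`, close to `-(k h) x`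
while the orbit of `x` stays near `x`. -/
theorem IsDiscreteResolvent.seminorm_orbit_le {h : ℝ≥0} {R : X →L[𝕜] X}
    (hR : IsDiscreteResolvent S h R) (hS : IsDecayingSemigroup Γ S)
    {p : Seminorm 𝕜 X} {x : X} {ε : ℝ} (k : ℕ)
    (hε : ∀ r ≤ k * h, p (S r x - x) ≤ ε) :
    p (S (k * h) (R x) - R x + (((k * h : ℝ≥0) : ℝ) : 𝕜) • x) ≤ (k * h : ℝ≥0) * ε := by
  have h1 := seminorm_pow_sub_nsmul_le (p := p) (S h) (-(((h : ℝ) : 𝕜) • x)) k (R x)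
  have e : S h (R x) - R x = -(((h : ℝ) : 𝕜) • x) := by
    rw [← hR.right_inv x, neg_sub]
  have e2 : (((k * h : ℝ≥0) : ℝ) : 𝕜) • x = k • (((h : ℝ) : 𝕜) • x) := by
    rw [← Nat.cast_smul_eq_nsmul 𝕜, smul_smul, NNReal.coe_mul, RCLike.ofReal_mul,
      NNReal.coe_natCast, RCLike.ofReal_natCast]
  rw [hS.pow, smul_neg, sub_neg_eq_add, ← e2] at h1
  refine h1.trans ?_
  calc _ ≤ ∑ i ∈ Finset.range k, h * ε := by
        refine Finset.sum_le_sum fun i hi => ?_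
        rw [e, map_neg, map_smul, sub_neg_eq_add, ← sub_eq_neg_add, ← smul_sub,
          seminorm_ofReal_smul p h.coe_nonneg, map_sub_rev, hS.pow]
        gcongr
        refine hε _ ?_
        gcongr
        exact (Finset.mem_range.1 hi).le
    _ = _ := by
        rw [Finset.sum_const, Finset.card_range, nsmul_eq_mul]
        push_cast
        ring

end DiscreteResolvent

/-! ### The orbit integral and surjectivity of `1 - A` -/

section GeneratorSurjective

variable {𝕜 X : Type*} [RCLike 𝕜] [NormedAddCommGroup X] [NormedSpace 𝕜 X]
  {Γ : Set (Seminorm 𝕜 X)} {S : ℝ≥0 → X →L[𝕜] X}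

theorem tendsto_inv_two_pow_nnreal :
    Tendsto (fun n : ℕ => ((2 : ℝ≥0)⁻¹) ^ n) atTop (𝓝 0) :=
  tendsto_pow_atTop_nhds_zero_of_lt_one (by positivity) (inv_lt_one_of_one_lt₀ one_lt_two)

theorem IsDecayingSemigroup.exists_delta (hS : IsDecayingSemigroup Γ S) {p : Seminorm 𝕜 X}
    (hp : p ∈ Γ) (x : X) {ε : ℝ} (hε : 0 < ε) :
    ∃ δ : ℝ≥0, 0 < δ ∧ ∀ r ≤ δ, p (S r x - x) ≤ ε := by
  have h := hS.continuous x 0 p hp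
  rw [hS.map_zero, Metric.tendsto_nhds_nhds] at h
  obtain ⟨δ, hδ, h⟩ := h ε hε
  refine ⟨⟨δ / 2, by positivity⟩, half_pos hδ, fun r hr => ?_⟩
  have hr' : (r : ℝ) ≤ δ / 2 := hr
  have h1 := h (x := r) (by
    rw [NNReal.dist_eq, NNReal.coe_zero, sub_zero, abs_of_nonneg r.coe_nonneg]
    linarith)
  rw [Real.dist_0_eq_abs, abs_of_nonneg (apply_nonneg p _)] at h1
  exact h1.le

/-- The element `y = ∫ S t x dt`, for which `S s y - y = -∫ S r x dr` over `r ≤ s`. -/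
theorem IsDecayingSemigroup.exists_orbit_integral [CompleteSpace X]
    (hS : IsDecayingSemigroup Γ S) (hΓ : IsNorming Γ) (hC : BoundedSeqComplete Γ) (x : X) :
    ∃ y, ∀ p ∈ Γ, ∀ (ε : ℝ) (δ : ℝ≥0), (∀ r ≤ δ, p (S r x - x) ≤ ε) →
      ∀ s ≤ δ, p (S s y - y + ((s : ℝ) : 𝕜) • x) ≤ s * ε := by
  -- Dyadic steps: each mesh refines all earlier ones, as the comparison of two discrete resolvents
  -- requires.
  set h : ℕ → ℝ≥0 := fun n => ((2 : ℝ≥0)⁻¹) ^ n with hh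
  have h0 : ∀ n, 0 < h n := fun n => by positivity
  have h1 : ∀ n, h n ≤ 1 := fun n => pow_le_one₀ (by positivity) (inv_le_one_of_one_le₀ one_le_two)
  have hlim : Tendsto h atTop (𝓝 0) := tendsto_inv_two_pow_nnreal
  choose R hR using fun n => hS.exists_isDiscreteResolvent hΓ (h0 n)
  have hRp : ∀ n, ∀ p ∈ Γ, p (R n x) ≤ 2 * p x := fun n p hp =>
    (hR n).seminorm_le hS (h0 n) (h1 n) hp x
  obtain ⟨y, hy⟩ := hC (fun n => R n x) ⟨2 * ‖x‖, fun n => hΓ.norm_le fun p hp =>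
      (hRp n p hp).trans (by gcongr; exact hΓ.le_norm hp x)⟩ (by
    intro p hp ε hε
    obtain ⟨δ, hδ, hd⟩ := hS.exists_delta hp x (by positivity : 0 < ε / 8)
    obtain ⟨N, hN⟩ := (hlim.eventually_lt_const hδ).exists
    have key : ∀ n ≥ N, p (R n x - R N x) ≤ 2 * (ε / 8) := by
      intro n hn
      obtain ⟨k, rfl⟩ := Nat.exists_eq_add_of_le hn
      have e : ((2 ^ k : ℕ) : ℝ≥0) * h (N + k) = h N := by
        simp only [hh]
        rw [pow_add, Nat.cast_pow, Nat.cast_ofNat, mul_left_comm, ← mul_pow,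
          mul_inv_cancel₀ two_ne_zero, one_pow, mul_one]
      refine (hR (N + k)).seminorm_sub_le (m := 2 ^ k) (by positivity) (h0 _)
        (by rw [e]; exact hR N) hS (by rw [e]; exact h1 N) hp fun r hr => hd r ?_
      rw [e] at hr
      exact hr.trans hN.le
    refine ⟨N, fun m hm n hn => ?_⟩
    have h3 := map_sub_le_add p (R m x - R N x) (R n x - R N x)
    rw [sub_sub_sub_cancel_right] at h3
    linarith [key m hm, key n hn])
  refine ⟨y, fun p hp ε δ hε s hs => ?_⟩
  -- Rounding down keeps the grid times at most `s ≤ δ`, where the hypothesis on the orbit of `x` is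
  -- available, and they still tend to `s`.
  set k : ℕ → ℕ := fun n => ⌊(s : ℝ) * 2 ^ n⌋₊ with hk
  have hks : ∀ n, (k n : ℝ≥0) * h n ≤ s := by
    intro n
    have h2 : ((k n : ℕ) : ℝ) ≤ s * 2 ^ n := Nat.floor_le (by positivity)
    rw [← NNReal.coe_le_coe, NNReal.coe_mul, NNReal.coe_natCast]
    simp only [hh, NNReal.coe_pow, NNReal.coe_inv, NNReal.coe_ofNat, inv_pow]
    rwa [← div_eq_mul_inv, div_le_iff₀ (by positivity)]
  have hkl : Tendsto (fun n => (k n : ℝ≥0) * h n) atTop (𝓝 s) := by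
    rw [← NNReal.tendsto_coe]
    have hl : Tendsto (fun n => (s : ℝ) - h n) atTop (𝓝 s) := by
      simpa using (NNReal.tendsto_coe.2 hlim).const_sub (s : ℝ)
    refine tendsto_of_tendsto_of_tendsto_of_le_of_le hl tendsto_const_nhds (fun n => ?_)
      (fun n => by exact_mod_cast hks n)
    have h2 : (s : ℝ) * 2 ^ n < k n + 1 := Nat.lt_floor_add_one _
    have h3 : (0 : ℝ) < 2 ^ n := by positivity
    simp only [hh, NNReal.coe_mul, NNReal.coe_natCast, NNReal.coe_pow, NNReal.coe_inv,
      NNReal.coe_ofNat, inv_pow]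
    rw [sub_le_iff_le_add, ← add_one_mul, ← div_eq_mul_inv, le_div_iff₀ h3]
    exact h2.le
  have hSy : SeminormTendsto Γ (fun n => S (k n * h n) (R n x)) atTop (S s y) := by
    have h2 : SeminormTendsto Γ (fun n => S (k n * h n) (R n x - y)) atTop 0 := by
      intro q hq
      refine squeeze_zero (fun _ => apply_nonneg q _) (fun n => ?_) (hy q hq)
      rw [sub_zero]
      exact hS.contraction _ hq _
    have h3 := h2.add ((hS.continuous y s).comp hkl)
    rw [zero_add] at h3
    simpa [map_sub] using h3
  have hsx : SeminormTendsto Γ (fun n => (((k n * h n : ℝ≥0) : ℝ) : 𝕜) • x) atTop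
      (((s : ℝ) : 𝕜) • x) :=
    (seminormTendsto_const x).smul_of_tendsto (NNReal.tendsto_coe.2 hkl)
  have hε0 : 0 ≤ ε := (apply_nonneg p _).trans (hε 0 zero_le)
  refine ((hSy.sub hy).add hsx).seminorm_le hp (Eventually.of_forall fun n => ?_)
  refine ((hR n).seminorm_orbit_le hS (k n) fun r hr => hε r (hr.trans ((hks n).trans hs))).trans ?_
  gcongr
  exact hks n

variable {A : X →ₗ.[𝕜] X} {T : ℝ≥0 → X →L[𝕜] X}

/-- The factor `exp (-t)` shifts the generator from `A` to `A - 1`, so integrating the rescaled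
orbit solves `(1 - A) y = x`. -/
theorem isDecayingSemigroup_exp_smul (h0 : ∀ x, T 0 x = x)
    (hadd : ∀ (t s : ℝ≥0) (x : X), T (t + s) x = T t (T s x))
    (hT : ∀ t : ℝ≥0, ∀ p ∈ Γ, ∀ x, p (T t x) ≤ p x)
    (hc : ∀ x t, SeminormTendsto Γ (fun s => T s x) (𝓝 t) (T t x)) :
    IsDecayingSemigroup Γ fun t => ((Real.exp (-t) : ℝ) : 𝕜) • T t where
  map_zero := by
    ext x
    simp [h0]
  map_add t s := by
    ext x
    simp only [NNReal.coe_add, neg_add, Real.exp_add, RCLike.ofReal_mul]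
    simp [hadd, mul_smul, smul_comm ((Real.exp (-t) : ℝ) : 𝕜)]
  decay t p hp x := by
    rw [smul_apply, seminorm_ofReal_smul p (Real.exp_pos _).le]
    gcongr
    exact hT t p hp x
  continuous x t :=
    (hc x t).smul_of_tendsto
      (((Real.continuous_exp.comp NNReal.continuous_coe.neg)).tendsto t)

theorem exists_resolvent_slope [CompleteSpace X] (hΓ : IsNorming Γ) (hC : BoundedSeqComplete Γ)
    (h0 : ∀ x, T 0 x = x) (hadd : ∀ (t s : ℝ≥0) (x : X), T (t + s) x = T t (T s x))
    (hT : ∀ t : ℝ≥0, ∀ p ∈ Γ, ∀ x, p (T t x) ≤ p x)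
    (hc : ∀ x t, SeminormTendsto Γ (fun s => T s x) (𝓝 t) (T t x)) (x : X) :
    ∃ y, SeminormTendsto Γ (fun t : ℝ≥0 => (((t : ℝ) : 𝕜)⁻¹) • (T t y - y)) (𝓝[>] 0) (y - x) ∧
      ∃ C : ℝ, ∀ t : ℝ≥0, 0 < t → t ≤ 1 → ‖T t y - y‖ / t ≤ C := by
  have hS := isDecayingSemigroup_exp_smul h0 hadd hT hc
  set S : ℝ≥0 → X →L[𝕜] X := fun t => ((Real.exp (-t) : ℝ) : 𝕜) • T t with hSdef
  obtain ⟨y, hy⟩ := hS.exists_orbit_integral hΓ hC x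
  have hTS : ∀ t : ℝ≥0, T t y = ((Real.exp t : ℝ) : 𝕜) • S t y := by
    intro t
    rw [hSdef, smul_apply, smul_smul, ← RCLike.ofReal_mul, ← Real.exp_add, add_neg_cancel,
      Real.exp_zero, RCLike.ofReal_one, one_smul]
  have hTy : ∀ t : ℝ≥0, T t y - y = ((Real.exp t : ℝ) : 𝕜) • (S t y - y)
      + ((Real.exp t - 1 : ℝ) : 𝕜) • y := by
    intro t
    rw [hTS, RCLike.ofReal_sub, sub_smul, smul_sub, RCLike.ofReal_one, one_smul]
    abel
  -- From the splitting `hTy`, for `t ≤ 1`: `‖S t y - y‖ ≤ 3 t ‖x‖`, `exp t ≤ exp 1` and `|exp t -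
  -- 1| ≤ 2 t`.
  refine ⟨y, ?_, Real.exp 1 * (3 * ‖x‖) + 2 * ‖y‖, fun t ht ht1 => ?_⟩
  · have hexp : Tendsto (fun t : ℝ≥0 => Real.exp t) (𝓝[>] 0) (𝓝 1) := by
      have h := (Real.continuous_exp.comp NNReal.continuous_coe).tendsto 0
      simp only [Function.comp_apply, NNReal.coe_zero, Real.exp_zero] at h
      exact h.mono_left nhdsWithin_le_nhds
    have hslope : Tendsto (fun t : ℝ≥0 => (t : ℝ)⁻¹ * (Real.exp t - 1)) (𝓝[>] 0) (𝓝 1) := by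
      have h := (Real.hasDerivAt_exp 0)
      rw [hasDerivAt_iff_tendsto_slope_zero] at h
      have hco : Tendsto (fun t : ℝ≥0 => (t : ℝ)) (𝓝[>] 0) (𝓝[≠] 0) := by
        refine tendsto_nhdsWithin_iff.2 ⟨?_, ?_⟩
        · exact (NNReal.continuous_coe.tendsto 0).mono_left nhdsWithin_le_nhds
        · filter_upwards [self_mem_nhdsWithin] with t ht
          exact (NNReal.coe_pos.2 ht).ne'
      simpa [Function.comp_def] using h.comp hco
    have hz : SeminormTendsto Γ (fun t : ℝ≥0 => (((t : ℝ)⁻¹ : ℝ) : 𝕜) •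
        (S t y - y + ((t : ℝ) : 𝕜) • x)) (𝓝[>] 0) 0 := by
      intro p hp
      rw [Metric.tendsto_nhds]
      intro ε hε
      obtain ⟨δ, hδ, hd⟩ := hS.exists_delta hp x (by positivity : 0 < ε / 2)
      filter_upwards [Ioc_mem_nhdsGT hδ] with t ht
      have ht0 : (0 : ℝ) < t := ht.1
      rw [Real.dist_0_eq_abs, abs_of_nonneg (apply_nonneg p _), sub_zero,
        seminorm_ofReal_smul p (inv_nonneg.2 ht0.le), inv_mul_lt_iff₀ ht0]
      refine (hy p hp _ δ hd t ht.2).trans_lt ?_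
      gcongr
      linarith
    have h1 := ((hz.smul_of_tendsto hexp).sub ((seminormTendsto_const x).smul_of_tendsto hexp)).add
      ((seminormTendsto_const y).smul_of_tendsto hslope)
    simp only [smul_zero, RCLike.ofReal_one, one_smul, zero_sub, neg_add_eq_sub] at h1
    intro p hp
    refine (h1 p hp).congr' ?_
    filter_upwards [self_mem_nhdsWithin] with t ht
    have hne : ((t : ℝ) : 𝕜) ≠ 0 := by exact_mod_cast (NNReal.coe_pos.2 ht).ne'
    congr 2
    rw [hTy, smul_add (((t : ℝ) : 𝕜)⁻¹), smul_smul _ _ y, RCLike.ofReal_mul, RCLike.ofReal_inv,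
      smul_add _ (S t y - y), smul_smul _ _ x, inv_mul_cancel₀ hne, one_smul, smul_add,
      add_sub_cancel_right, smul_comm]
  · have ht0 : (0 : ℝ) < t := ht
    have ht1' : (t : ℝ) ≤ 1 := ht1
    have hS3 : ‖S t y - y‖ ≤ t * (3 * ‖x‖) := hΓ.norm_le fun p hp => by
      -- The crude choice `ε = 2 p x` is valid for every `δ` by contractivity; restoring `t x` adds
      -- one more `t p x`, whence the `3`.
      have h2 := hy p hp (2 * p x) t (fun r _ => by
        have := map_sub_le_add p (S r x) x
        linarith [hS.contraction r hp x]) t le_rfl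
      have h3 := map_sub_le_add p (S t y - y + ((t : ℝ) : 𝕜) • x) (((t : ℝ) : 𝕜) • x)
      rw [add_sub_cancel_right, seminorm_ofReal_smul p ht0.le] at h3
      have h4 : (t : ℝ) * p x ≤ t * ‖x‖ := by
        gcongr
        exact hΓ.le_norm hp x
      linarith
    have he : ‖((Real.exp t - 1 : ℝ) : 𝕜)‖ ≤ 2 * t := by
      rw [RCLike.norm_ofReal]
      have := Real.abs_exp_sub_one_le (x := t) (by rwa [abs_of_pos ht0])
      rwa [abs_of_pos ht0] at this
    rw [div_le_iff₀ ht0, hTy]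
    calc _ ≤ ‖((Real.exp t : ℝ) : 𝕜)‖ * ‖S t y - y‖ + ‖((Real.exp t - 1 : ℝ) : 𝕜)‖ * ‖y‖ := by
          rw [← norm_smul, ← norm_smul]
          exact norm_add_le _ _
      _ ≤ Real.exp 1 * (t * (3 * ‖x‖)) + 2 * t * ‖y‖ := by
          gcongr
          rw [RCLike.norm_ofReal, abs_of_pos (Real.exp_pos _)]
          exact Real.exp_le_exp.2 ht1'
      _ = _ := by ring

end GeneratorSurjective

/-! ### Consequences for a bi-continuous semigroup and its generator -/

section Main

variable {𝕜 X : Type*} [RCLike 𝕜] [NormedAddCommGroup X] [NormedSpace 𝕜 X]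
  {Γ : Set (Seminorm 𝕜 X)} {A : X →ₗ.[𝕜] X} {T : ℝ≥0 → X →L[𝕜] X} {τ υ : TopologicalSpace X}

/-- Orbits are bounded by `‖x‖`, and sequences suffice to test limits at points of `ℝ≥0`, so
`τ`-continuity upgrades to `Γ`. -/
theorem IsBiContinuousSemigroup.seminormTendsto (hT : IsBiContinuousSemigroup T τ)
    (hΓ : IsNorming Γ) (hτ : BoundedSeqContinuous τ Γ)
    (hTp : ∀ t : ℝ≥0, ∀ p ∈ Γ, ∀ x, p (T t x) ≤ p x) (x : X) (t : ℝ≥0) :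
    SeminormTendsto Γ (fun s => T s x) (𝓝 t) (T t x) := by
  intro p hp
  refine tendsto_of_seq_tendsto fun s hs => ?_
  refine hτ (fun n => T (s n) x) (T t x) ⟨‖x‖, fun n => hΓ.norm_le fun q hq =>
    (hTp _ q hq x).trans (hΓ.le_norm hq x)⟩ ?_ p hp
  exact ((@Continuous.tendsto ℝ≥0 X _ τ _ (hT.strongly_continuous x)) t).comp hs

theorem IsGenerator.surjective [CompleteSpace X] (hA : IsGenerator T τ A)
    (hT : IsBiContinuousSemigroup T τ) (hΓ : IsNorming Γ) (hυ : IsGeneratingSystem υ Γ)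
    (hυτ : υ ≤ τ) (hτ : BoundedSeqContinuous τ Γ) (hC : BoundedSeqComplete Γ)
    (hTp : ∀ t : ℝ≥0, ∀ p ∈ Γ, ∀ x, p (T t x) ≤ p x) :
    Function.Surjective (fun x : A.domain => ((1 : ℝ) : 𝕜) • (x : X) - A x) := by
  intro x
  obtain ⟨y, hy, hb⟩ := exists_resolvent_slope hΓ hC hT.map_zero hT.map_add hTp
    (hT.seminormTendsto hΓ hτ hTp) x
  obtain ⟨hyA, hAy⟩ := (hA y (y - x)).2 ⟨hυ.tendsto_of_le hυτ hy, hb⟩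
  refine ⟨⟨y, hyA⟩, ?_⟩
  simp only [hAy]
  rw [RCLike.ofReal_one, one_smul, sub_sub_cancel]

end Main

end BiCont

theorem mainTheorem5 {𝕜 X : Type*} [RCLike 𝕜] [NormedAddCommGroup X] [NormedSpace 𝕜 X]
    [CompleteSpace X]
    (τ : TopologicalSpace X) (hτ : BiCont.IsSeqCompleteSaksSpace 𝕜 τ)
    (υ : TopologicalSpace X) (hυ : BiCont.IsHausdorffLocallyConvex 𝕜 υ)
    (hτυ : υ ≤ τ) (hυn : BiCont.normTopology X ≤ υ)
    (hγυ : ∀ (u : ℕ → X) (x : X),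
      Tendsto u atTop (@nhds X (BiCont.mixedTopology 𝕜 τ) x) → Tendsto u atTop (@nhds X υ x))
    (A : X →ₗ.[𝕜] X) (hA : BiCont.IsBiDenselyDefined τ A) :
    (∃ T : ℝ≥0 → BiCont.BoundedOperator 𝕜 X,
      BiCont.IsBiContinuousSemigroup T τ ∧ BiCont.IsContraction T ∧ BiCont.IsGenerator T τ A ∧
      ∃ Γ : Set (Seminorm 𝕜 X), BiCont.IsGeneratingSystem υ Γ ∧ BiCont.IsNorming Γ ∧
        ∀ t : ℝ≥0, ∀ p ∈ Γ, ∀ x : X, p (T t x) ≤ p x) ↔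
    ((∃ l : ℝ, 0 < l ∧ Function.Surjective (fun x : A.domain => (l : 𝕜) • (x : X) - A x)) ∧
      ∃ Γ : Set (Seminorm 𝕜 X), BiCont.IsGeneratingSystem υ Γ ∧ BiCont.IsNorming Γ ∧
        BiCont.IsDissipative Γ A) := by
  have hseq : ∀ Γ : Set (Seminorm 𝕜 X), BiCont.IsGeneratingSystem υ Γ →
      BiCont.BoundedSeqContinuous τ Γ := fun Γ hΓ u x hb hu =>
    BiCont.seminormTendsto_of_bounded hτ.saks hγυ hΓ hb hu
  constructor
  · rintro ⟨T, hT, -, hgen, Γ, hΓυ, hΓ, hTp⟩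
    have hC := BiCont.boundedSeqComplete hτ hτυ hγυ hΓυ
    exact ⟨⟨1, one_pos, hgen.surjective hT hΓ hΓυ hτυ (hseq Γ hΓυ) hC hTp⟩, Γ, hΓυ, hΓ,
      hgen.isDissipative (hseq Γ hΓυ) hTp⟩
  · rintro ⟨⟨l, hl, hs⟩, Γ, hΓυ, hΓ, hD⟩
    have hC := BiCont.boundedSeqComplete hτ hτυ hγυ hΓυ
    obtain ⟨T, hT, hT1, hgen, hTp⟩ :=
      hD.exists_semigroup hΓ hΓυ hτυ (hseq Γ hΓυ) hC hA hl hs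
    exact ⟨T, hT, hT1, hgen, Γ, hΓυ, hΓ, hTp⟩
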